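/- Let $\hat S(\hat t)=e^{\hat t\hat A}$, $\hat t\ge 0$, be a strongly continuous semigroup with $\hat S(0)=I$ on a complex Hilbert space $\mathcal H$, with generator $\hat A$. Let $\hat\omega\in\mathbb R$ be such that the half-plane $\{\Re z>\hat\omega\}$ lies in the resolvent set of $\hat A$, and let $\hat r\in\,]0,\infty[$ be given by $$\frac1{\hat r}=\sup_{\Re z>\hat\omega}\|(z-\hat A)^{-1}\|.$$ Let $0<\hat m\in C^1([0,\infty[)$ satisfy $\|\hat S(\hat t)\|\le\hat m(\hat t)$ for all $\hat t>0$. *Definitions.* For $0<m\in C^1([0,\infty[)$ and $a>0$, let $\lambda^{DR}(a,m)$ be the lowest eigenvalue of the realization of $K_m=-m^{-2}\,\partial_s\circ m^2\,\partial_s-1$ on $]0,a[$ with domain $\{u\in H^2(]0,a[):u(0)=0,\ u'(a)=u(a)\}$. Put $$a^*(m)=\sup\{c\in\,]0,\infty[\,:\ \lambda^{DR}(a,m)>0\text{ for }0<a<c\},\qquad \psi_0(s;m)=\frac{u_0'(s)}{u_0(s)}\quad(s\in\,]0,\infty[\,\cap\,]0,a^*(m)]),$$ where $u_0$ is a first eigenfunction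 of this problem on $]0,a^*(m)[$ if $a^*(m)<\infty$, and is a nontrivial solution of $K_mu_0=0$ on $]0,\infty[$ with $u_0(0)=0$ if $a^*(m)=\infty$. Finally, let $m(s)=e^{-\hat\omega s/\hat r}\,\hat m(s/\hat r)$, i.e. $m(s)=e^{-\hat\omega\hat s}\hat m(\hat s)$ with $s=\hat r\hat s$. *Theorem.* There exist a unique $\hat a^*\in\,]0,+\infty]$ and a unique function $\hat\psi$ on $]0,\infty[\,\cap\,]0,\hat a^*]$ with the following property: there is a nontrivial solution $\hat u$ on $[0,\infty[$ of $$\frac1{\hat r}\partial_{\hat s}\Big((e^{-\hat\omega\hat s}\hat m)^2\,\frac1{\hat r}\partial_{\hat s}\hat u\Big)+(e^{-\hat\omega\hat s}\hat m)^2\,\hat u=0,\qquad \hat u(0)=0,$$ such that $0<\hat u<\hat u'/\hat r$ on $]0,\hat a^*[$, $\hat u'(\hat a^*)/\hat r=\hat u(\hat a^*)>0$ if $\hat a^*<\infty$, and $\hat\psi=(\hat u'/\hat r)/\hat u$. Moreover $u_0$ exists for the weight $m$ and $$\hat r\,\hat a^*=a^*(m),\qquad \hat\psi(\hat s)=\psi_0(\hat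 r\hat s;m)\quad(\hat s\in\,]0,\infty[\,\cap\,]0,\hat a^*]).$$ If $\hat a,\hat b\in\,]0,\infty[\,\cap\,]0,\hat a^*]$ and $\hat t>\hat a+\hat b$, then $$\|\hat S(\hat t)\|\le \exp\big((\hat\omega-\hat r)(\hat t-(\hat a+\hat b))\big)\,\hat m(\hat a)\,\hat m(\hat b)\,\hat\psi(\hat a)^{1/2}\,\hat\psi(\hat b)^{1/2}.$$ If $\hat a^*<\infty$, the choice $\hat a=\hat b=\hat a^*$ is optimal, in the sense that for every $\hat t$ it minimizes the right-hand side over $\hat a,\hat b\in\,]0,\hat a^*]$; for this choice the right-hand side equals $\exp((\hat\omega-\hat r)(\hat t-2\hat a^*))\,\hat m(\hat a^*)^2$, so that $$\|\hat S(\hat t)\|\le \exp\big((\hat\omega-\hat r)(\hat t-2\hat a^*)\big)\,\hat m(\hat a^*)^2,\qquad \hat t>2\hat a^*.$$ -/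

import Mathlib

open MeasureTheory Set Filter Topology

noncomputable section

/-- A strongly continuous semigroup `S(t)`, `t ≥ 0`, of bounded operators on `H` with `S(0) = I`.
Only the values of `toFun` at `t ≥ 0` are meaningful. -/
structure StrongSemigroup (H : Type*) [NormedAddCommGroup H] [InnerProductSpace ℂ H] where
  toFun : ℝ → H →L[ℂ] H
  map_zero : toFun 0 = ContinuousLinearMap.id ℂ H
  map_add : ∀ s t : ℝ, 0 ≤ s → 0 ≤ t → toFun (s + t) = (toFun s).comp (toFun t)
  strong_cont : ∀ x : H, ContinuousOn (fun t => toFun t x) (Ici 0)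

namespace StrongSemigroup

variable {H : Type*} [NormedAddCommGroup H] [InnerProductSpace ℂ H]

/-- The graph of the generator `A` of the semigroup: `x ∈ D(A)` and `A x = y`, that is,
`(S(h) x - x) / h → y` as `h → 0+`. -/
def GeneratorAt (S : StrongSemigroup H) (x y : H) : Prop :=
  Tendsto (fun h : ℝ => h⁻¹ • (S.toFun h x - x)) (𝓝[>] 0) (𝓝 y)

/-- `z` belongs to the resolvent set of the generator `A`, and `R = (z - A)⁻¹`: the bounded
operator `R` is a left inverse of `z - A` on `D(A)`, maps `H` into `D(A)`, and is a right inverse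
of `z - A`. -/
def IsResolventAt (S : StrongSemigroup H) (z : ℂ) (R : H →L[ℂ] H) : Prop :=
  (∀ x y : H, S.GeneratorAt x y → R (z • x - y) = x) ∧
    ∀ y : H, S.GeneratorAt (R y) (z • R y - y)

/-- The open half-plane `Re z > ω` lies in the resolvent set of the generator `A`, and `r > 0` is
the number `r(ω)` given by `1 / r(ω) = sup_{Re z > ω} ‖(z - A)⁻¹‖`. -/
def HasResolventRadius (S : StrongSemigroup H) (ω r : ℝ) : Prop :=
  0 < r ∧ (∀ z : ℂ, ω < z.re → ∃ R : H →L[ℂ] H, S.IsResolventAt z R) ∧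
    IsLUB {c : ℝ | ∃ (z : ℂ) (R : H →L[ℂ] H), ω < z.re ∧ S.IsResolventAt z R ∧ c = ‖R‖} (1 / r)

end StrongSemigroup

/-- `u` belongs to the Sobolev space `H²(]0,a[)` (real-valued, continuous representatives on
`[0,a]`), with first derivative `v` and second (weak) derivative `w ∈ L²(]0,a[)`. -/
structure IsSobolevTwo (a : ℝ) (u v w : ℝ → ℝ) : Prop where
  memLp : MemLp w 2 (volume.restrict (Ioo 0 a))
  fst_deriv : ∀ s ∈ Icc 0 a, u s = u 0 + ∫ t in (0 : ℝ)..s, v t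
  snd_deriv : ∀ s ∈ Icc 0 a, v s = v 0 + ∫ t in (0 : ℝ)..s, w t

/-- The value at `s` of `K u = - m⁻² (r⁻¹ ∂) (m² (r⁻¹ ∂ u)) - u`, where `v = u'`, `w = u''`; the
inner derivative `∂ (m² v) = m² w + 2 m m' v` is expanded by the product rule. For `r = 1` this is
`K_m = - m⁻² ∂ ∘ m² ∂ - 1`. -/
def opK (r : ℝ) (m u v w : ℝ → ℝ) (s : ℝ) : ℝ :=
  -(1 / m s ^ 2) * (1 / r ^ 2 * (m s ^ 2 * w s + 2 * m s * deriv m s * v s)) - u s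

/-- `u`, with derivative `v`, is an eigenfunction with eigenvalue `l` of the Dirichlet-Robin
realization of `K_m` on `]0,a[`, whose domain is
`{u ∈ H²(]0,a[) ; u(0) = 0, u'(a) = u(a)}`. -/
def IsDREigenfunction (m : ℝ → ℝ) (a l : ℝ) (u v : ℝ → ℝ) : Prop :=
  ∃ w : ℝ → ℝ, IsSobolevTwo a u v w ∧ u 0 = 0 ∧ v a = u a ∧ (∃ s ∈ Icc 0 a, u s ≠ 0) ∧
    ∀ᵐ s ∂(volume.restrict (Ioo 0 a)), opK 1 m u v w s = l * u s

/-- The lowest eigenvalue of the Dirichlet-Robin realization of `K_m` on `]0,a[`. -/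
def lambdaDR (m : ℝ → ℝ) (a : ℝ) : ℝ :=
  sInf {l : ℝ | ∃ u v : ℝ → ℝ, IsDREigenfunction m a l u v}

/-- `a*(m) = sup {c ∈ ]0,∞[ ; lambdaDR m a > 0 for 0 < a < c}`, an extended real number. -/
def aStar (m : ℝ → ℝ) : EReal :=
  sSup ((fun c : ℝ => (c : EReal)) ''
    {c : ℝ | 0 < c ∧ ∀ a : ℝ, 0 < a → a < c → 0 < lambdaDR m a})

/-- `u`, with derivative `v`, is in `H²` of every bounded interval `]0,b[` and solves there
`(r⁻¹ ∂) (m² (r⁻¹ ∂ u)) + m² u = 0`, with `u(0) = 0`, and `u` is not identically `0`. -/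
def IsHarmonicFromZero (r : ℝ) (m u v : ℝ → ℝ) : Prop :=
  (∀ b : ℝ, 0 < b → ∃ w : ℝ → ℝ, IsSobolevTwo b u v w ∧
    ∀ᵐ s ∂(volume.restrict (Ioo 0 b)), opK r m u v w s = 0) ∧
  u 0 = 0 ∧ ∃ s : ℝ, 0 < s ∧ u s ≠ 0

/-- `u`, with derivative `v`, is a function `u₀` attached to `m`, so that `ψ₀(·; m) = v / u`.
If `a*(m)` is finite, `u₀` is a first eigenfunction of the Dirichlet-Robin problem on `]0,a*(m)[`;
if `a*(m) = +∞`, it is a nontrivial `m`-harmonic function on `]0,+∞[` with `u₀(0) = 0`. -/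
def IsFirstFunction (m u v : ℝ → ℝ) : Prop :=
  (∀ a : ℝ, aStar m = a → IsDREigenfunction m a (lambdaDR m a) u v) ∧
    (aStar m = ⊤ → IsHarmonicFromZero 1 m u v)

/-- The pair `(â*, ψ̂) = (A, ψ)` attached to `(m̂, ω, r)`. There is a solution `û` on `[0,+∞[` of
`(r⁻¹ ∂) (e^{-ω s} m̂)² (r⁻¹ ∂) û + (e^{-ω s} m̂)² û = 0` with `û(0) = 0`, such that
`0 < û < û' / r` on `]0,A[`, and `û'(A) / r = û(A) > 0` if `A < ∞`; and `ψ = (û' / r) / û` on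
`]0,∞[ ∩ ]0,A]`. -/
def IsHatPair (ω r : ℝ) (m : ℝ → ℝ) (A : EReal) (ψ : ℝ → ℝ) : Prop :=
  0 < A ∧ ∃ u v : ℝ → ℝ,
    IsHarmonicFromZero r (fun s => Real.exp (-(ω * s)) * m s) u v ∧
    (∀ s : ℝ, 0 < s → (s : EReal) < A → 0 < u s ∧ u s < v s / r) ∧
    (∀ c : ℝ, A = c → 0 < u c ∧ v c / r = u c) ∧
    ∀ s : ℝ, 0 < s → (s : EReal) ≤ A → ψ s = (v s / r) / u s

/-- The rescaled weight `m(s) = e^{-ω ŝ} m̂(ŝ)`, `s = r ŝ`. -/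
def rescaledWeight (ω r : ℝ) (m : ℝ → ℝ) (s : ℝ) : ℝ :=
  Real.exp (-(ω * (s / r))) * m (s / r)

/-- `exp((ω - r)(t - (a + b))) m(a) m(b) ψ(a)^{1/2} ψ(b)^{1/2}`. -/
def hatBound (ω r : ℝ) (m ψ : ℝ → ℝ) (t a b : ℝ) : ℝ :=
  Real.exp ((ω - r) * (t - (a + b))) * m a * m b * Real.sqrt (ψ a) * Real.sqrt (ψ b)

end

/-! The proof combines an energy inequality for the semigroup with the Sturm–Liouville theory of the
weight.

*Energy inequality.* Put `G(s) = (e^{-ω s} ‖S(s)x‖)²`. If `χ(0) = 0`, integration by parts shows that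
`(z - A)⁻¹` maps the Laplace transform of `χ' S(·)x` at `z` to that of `χ S(·)x`
(`resolvent_fourier_weightedOrbit`). By Plancherel's theorem on the line `Re z = σ > ω`, the bound
`‖(z - A)⁻¹‖ ≤ 1 / r` becomes `∫ e^{-2σs} (r² χ² - χ'²) ‖S(s)x‖² ds ≤ 0`, provided the orbit grows
more slowly than `e^{σ s}`. Applied to truncated exponentials `χ`, this inequality improves the growth
rate itself (`orbit_decay_step`), so that every orbit decays faster than `e^{ω s}` and `σ = ω` is
allowed (`energy_inequality`): `∫ (r² χ² - χ'²) G ≤ 0`.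

*Choice of the multiplier.* Let `M = e^{-ω s} m` and let `u` solve `(M² u')' + r² M² u = 0`,
`u(0) = 0`, with momentum `p = M² u'`. The multiplier is `u / u(a)` on `[0, a]`, the neutral
exponential `e^{r(s - a)}` on `[a, t - b]`, a multiple of `p(t - s)` on `[t - b, t]`, and constant
afterwards. On the first interval `χ' ≥ r χ`, and `G ≤ M² ‖x‖²` bounds the contribution from below;
on the third `|χ'| ≤ r χ`, and `G(s) ≥ G(t) / M(t - s)²` does. Both signs express `u' ≥ r u`, which
holds up to `a*`. Both integrals are evaluated from `(p u)' = p² / M² - r² M² u²`, and the result is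
the estimate (`StrongSemigroup.orbit_le`). It is optimal at `a = b = a*`, because `e^{2 r s} M² ψ`
has the derivative `- r M² e^{2 r s} (ψ - 1)²` (`IsFlow.exp_mul_ratio_antitone`).

*The length `a*`.* For `r = 1`, the first point where `u' = u` is `a*(m)`
(`IsFirstRobinPoint.aStar_eq`). Before it, a shooting argument in the spectral parameter finds a
Dirichlet–Robin eigenvalue `λ > 0` with a positive eigenfunction (`exists_robin_parameter`); at it,
`u` is such an eigenfunction for `λ = 0`. Picone's identity shows that an eigenvalue with a positive
eigenfunction is the lowest one (`IsFlow.le_of_robin`, `lambdaDR_eq`). All uniqueness statements,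
and the identification of `ψ` with `ψ₀`, come from the Wronskian: two solutions that vanish at `0`
have the same logarithmic derivative. -/

noncomputable section

/-! ### Plancherel's theorem on `L¹ ∩ L²` -/

open FourierTransform in
/-- On `L¹ ∩ L²` the `L²` Fourier transform is given by the Fourier integral: both define the same
tempered distribution. -/
theorem fourier_toLp_two_ae_eq {H : Type*} [NormedAddCommGroup H] [InnerProductSpace ℂ H]
    [CompleteSpace H] {f : ℝ → H} (hf1 : Integrable f) (hf2 : MemLp f 2) :
    (𝓕 (hf2.toLp f) : Lp (α := ℝ) H 2 volume) =ᵐ[volume] 𝓕 f := by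
  have hL : Continuous fun p : ℝ × ℝ ↦ (innerₗ ℝ) p.1 p.2 := by
    simpa using (continuous_inner : Continuous fun p : ℝ × ℝ ↦ inner ℝ p.1 p.2)
  have hcont : Continuous (𝓕 f) :=
    VectorFourier.fourierIntegral_continuous Real.continuous_fourierChar hL hf1
  apply ae_eq_of_integral_contDiff_smul_eq
  · exact (Lp.memLp _).locallyIntegrable (by norm_num)
  · exact hcont.locallyIntegrable
  intro g hg hgs
  have hg₁ : HasCompactSupport (Complex.ofRealCLM ∘ g) := hgs.comp_left rfl
  have hg₂ : ContDiff ℝ (⊤ : ℕ∞) (Complex.ofRealCLM ∘ g) := by fun_prop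
  have h1 := congrArg (fun T => T (hg₁.toSchwartzMap hg₂))
    (Lp.fourier_toTemperedDistribution_eq (hf2.toLp f))
  simp only [TemperedDistribution.fourier_apply, Lp.toTemperedDistribution_apply] at h1
  have h2 : ∫ x, (g x) • (𝓕 (hf2.toLp f) : Lp (α := ℝ) H 2 volume) x =
      ∫ x, (hg₁.toSchwartzMap hg₂) x • (𝓕 (hf2.toLp f) : Lp (α := ℝ) H 2 volume) x := by
    congr 1
  rw [h2, ← h1]
  have h3 : ∫ x, (𝓕 (hg₁.toSchwartzMap hg₂)) x • (hf2.toLp f) x =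
      ∫ x, (𝓕 (hg₁.toSchwartzMap hg₂)) x • f x := by
    apply integral_congr_ae
    filter_upwards [hf2.coeFn_toLp] with x hx
    rw [hx]
  rw [h3]
  have h4 := VectorFourier.integral_fourierIntegral_smul_eq_flip (μ := volume) (ν := volume)
    (L := innerₗ ℝ) Real.continuous_fourierChar hL ((hg₁.toSchwartzMap hg₂).integrable) hf1
  rw [flip_innerₗ] at h4
  exact h4

open FourierTransform in
/-- Plancherel's theorem for the integral Fourier transform of `f ∈ L¹ ∩ L²`. -/
theorem plancherel_of_integrable {H : Type*} [NormedAddCommGroup H] [InnerProductSpace ℂ H]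
    [CompleteSpace H] {f : ℝ → H} (hf1 : Integrable f) (hf2 : MemLp f 2) :
    MemLp (𝓕 f) 2 ∧ ∫ ξ, ‖𝓕 f ξ‖ ^ 2 = ∫ s, ‖f s‖ ^ 2 := by
  have hae := fourier_toLp_two_ae_eq hf1 hf2
  have hm : MemLp (𝓕 f) 2 := (memLp_congr_ae hae).1 (Lp.memLp _)
  refine ⟨hm, ?_⟩
  have key : ∀ g : Lp (α := ℝ) H 2 volume, ‖g‖ ^ 2 = ∫ x, ‖g x‖ ^ 2 := by
    intro g
    rw [← inner_self_eq_norm_sq (𝕜 := ℂ), L2.inner_def, ← integral_re (L2.integrable_inner g g)]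
    congr 1
    ext x
    exact inner_self_eq_norm_sq _
  calc ∫ ξ, ‖𝓕 f ξ‖ ^ 2 = ∫ ξ, ‖(𝓕 (hf2.toLp f) : Lp (α := ℝ) H 2 volume) ξ‖ ^ 2 := by
        apply integral_congr_ae
        filter_upwards [hae] with x hx
        rw [hx]
    _ = ∫ s, ‖(hf2.toLp f) s‖ ^ 2 := by
        rw [← key, ← key, Lp.norm_fourier_eq]
    _ = ∫ s, ‖f s‖ ^ 2 := by
        apply integral_congr_ae
        filter_upwards [hf2.coeFn_toLp] with x hx
        rw [hx]

/-! ### Orbits, the generator and its resolvent -/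

namespace StrongSemigroup

variable {H : Type*} [NormedAddCommGroup H] [InnerProductSpace ℂ H]

theorem exists_exp_bound (S : StrongSemigroup H) {m : ℝ → ℝ} (hm : ContinuousOn m (Ici 0))
    (hS : ∀ t : ℝ, 0 < t → ‖S.toFun t‖ ≤ m t) :
    ∃ C γ : ℝ, 0 ≤ C ∧ ∀ t : ℝ, 0 ≤ t → ‖S.toFun t‖ ≤ C * Real.exp (γ * t) := by
  obtain ⟨B, hB⟩ := (isCompact_Icc (a := (0 : ℝ)) (b := 1)).bddAbove_image
    (hm.mono Icc_subset_Ici_self)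
  set C := max B 1 with hC
  have hC1 : 1 ≤ C := le_max_right _ _
  have hC0 : 0 < C := by linarith
  have h01 : ∀ t ∈ Icc (0 : ℝ) 1, ‖S.toFun t‖ ≤ C := by
    intro t ht
    rcases ht.1.eq_or_lt with h | h
    · rw [← h, S.map_zero]
      exact ContinuousLinearMap.norm_id_le.trans hC1
    · exact (hS t h).trans ((hB (mem_image_of_mem m ht)).trans (le_max_left _ _))
  have hn : ∀ n : ℕ, ∀ t ∈ Icc (0 : ℝ) 1, ‖S.toFun (n + t)‖ ≤ C ^ (n + 1) := by
    intro n
    induction n with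
    | zero => intro t ht; simpa using h01 t ht
    | succ k ih =>
      intro t ht
      have : ((k + 1 : ℕ) : ℝ) + t = 1 + (k + t) := by push_cast; ring
      rw [this, S.map_add 1 (k + t) zero_le_one (add_nonneg k.cast_nonneg ht.1), pow_succ']
      exact (ContinuousLinearMap.opNorm_comp_le _ _).trans
        (mul_le_mul (h01 1 ⟨zero_le_one, le_rfl⟩) (ih t ht) (norm_nonneg _) hC0.le)
  refine ⟨C, Real.log C, hC0.le, fun t ht => ?_⟩
  have hfl := Nat.floor_le ht
  have hfl' := Nat.lt_floor_add_one t
  have h1 := hn ⌊t⌋₊ (t - ⌊t⌋₊) ⟨by linarith, by linarith⟩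
  rw [add_sub_cancel] at h1
  refine h1.trans ?_
  have h2 : C ^ ⌊t⌋₊ = Real.exp (Real.log C * ⌊t⌋₊) := by
    rw [mul_comm, Real.exp_nat_mul, Real.exp_log hC0]
  rw [pow_succ', h2]
  exact mul_le_mul_of_nonneg_left (Real.exp_le_exp.2
    (mul_le_mul_of_nonneg_left hfl (Real.log_nonneg hC1))) hC0.le

theorem GeneratorAt.map {S : StrongSemigroup H} {x y : H} (h : S.GeneratorAt x y) {s : ℝ}
    (hs : 0 ≤ s) : S.GeneratorAt (S.toFun s x) (S.toFun s y) := by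
  have h1 := ((S.toFun s).continuous.tendsto y).comp h
  refine h1.congr' ?_
  filter_upwards [self_mem_nhdsWithin] with τ hτ
  have hτ : 0 ≤ τ := le_of_lt hτ
  have e1 := congrArg (fun T => T x) (S.map_add s τ hs hτ)
  have e2 := congrArg (fun T => T x) (S.map_add τ s hτ hs)
  rw [add_comm] at e2
  simp only [ContinuousLinearMap.comp_apply] at e1 e2
  simp only [Function.comp_apply]
  rw [← e2, e1, ContinuousLinearMap.map_smul_of_tower, map_sub]

theorem GeneratorAt.hasDerivWithinAt {S : StrongSemigroup H} {x y : H} (h : S.GeneratorAt x y)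
    {s : ℝ} (hs : 0 ≤ s) :
    HasDerivWithinAt (fun t => S.toFun t x) (S.toFun s y) (Ioi s) s := by
  rw [hasDerivWithinAt_iff_tendsto_slope' (by simp)]
  have h1 := ((S.toFun s).continuous.tendsto y).comp h
  have h2 : Tendsto (fun t => t - s) (𝓝[>] s) (𝓝[>] 0) := by
    refine tendsto_nhdsWithin_iff.2 ⟨?_, ?_⟩
    · refine (Continuous.tendsto' (by fun_prop) _ _ (by simp)).mono_left nhdsWithin_le_nhds
    · filter_upwards [self_mem_nhdsWithin] with t ht
      simpa using ht
  refine (h1.comp h2).congr' ?_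
  filter_upwards [self_mem_nhdsWithin] with t ht
  have ht : s < t := ht
  have e1 := congrArg (fun T => T x) (S.map_add s (t - s) hs (by linarith))
  rw [add_sub_cancel] at e1
  simp only [ContinuousLinearMap.comp_apply] at e1
  simp only [Function.comp_apply, slope_def_module, e1, ContinuousLinearMap.map_smul_of_tower,
    map_sub]

theorem IsResolventAt.commute {S : StrongSemigroup H} {z : ℂ} {R : H →L[ℂ] H}
    (h : S.IsResolventAt z R) {s : ℝ} (hs : 0 ≤ s) (x : H) :
    R (S.toFun s x) = S.toFun s (R x) := by
  have h1 := h.1 _ _ ((h.2 x).map hs)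
  rw [← h1]
  congr 1
  simp

theorem HasResolventRadius.norm_le {S : StrongSemigroup H} {ω r : ℝ}
    (h : S.HasResolventRadius ω r) {z : ℂ} (hz : ω < z.re) {R : H →L[ℂ] H}
    (hR : S.IsResolventAt z R) : ‖R‖ ≤ 1 / r :=
  h.2.2.1 ⟨z, R, hz, hR, rfl⟩

/-- The extension by zero to the real line of the weighted orbit `φ(s) e^{-σ s} S(s) x`, `s > 0`. -/
def weightedOrbit (S : StrongSemigroup H) (x : H) (σ : ℝ) (φ : ℝ → ℝ) : ℝ → H :=
  indicator (Ioi 0) fun s => (φ s * Real.exp (-(σ * s))) • S.toFun s x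

theorem aestronglyMeasurable_weightedOrbit (S : StrongSemigroup H) (x : H) (σ : ℝ) {φ : ℝ → ℝ}
    (hφ : Measurable φ) : AEStronglyMeasurable (S.weightedOrbit x σ φ) volume := by
  refine (aestronglyMeasurable_indicator_iff measurableSet_Ioi).2 ?_
  have h1 : Measurable fun s => φ s * Real.exp (-(σ * s)) := hφ.mul (by fun_prop)
  exact h1.aestronglyMeasurable.smul
    (((S.strong_cont x).mono Ioi_subset_Ici_self).aestronglyMeasurable measurableSet_Ioi)

theorem norm_weightedOrbit_le (S : StrongSemigroup H) {x : H} {σ₀ σ C B : ℝ} {φ : ℝ → ℝ}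
    (hx : ∀ s, 0 ≤ s → ‖S.toFun s x‖ ≤ C * Real.exp (σ₀ * s)) (hB : ∀ s, |φ s| ≤ B) (s : ℝ) :
    ‖S.weightedOrbit x σ φ s‖ ≤
      indicator (Ioi 0) (fun s => B * C * Real.exp (-(σ - σ₀) * s)) s := by
  have hB0 : 0 ≤ B := (abs_nonneg _).trans (hB 0)
  rw [weightedOrbit, norm_indicator_eq_indicator_norm]
  refine indicator_le_indicator' fun hs => ?_
  have hs : 0 < s := hs
  rw [norm_smul, Real.norm_eq_abs, abs_mul, abs_of_pos (Real.exp_pos _)]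
  have h1 : Real.exp (-(σ - σ₀) * s) = Real.exp (-(σ * s)) * Real.exp (σ₀ * s) := by
    rw [← Real.exp_add]; congr 1; ring
  calc |φ s| * Real.exp (-(σ * s)) * ‖S.toFun s x‖
      ≤ B * Real.exp (-(σ * s)) * (C * Real.exp (σ₀ * s)) := by
        gcongr
        · exact hB s
        · exact hx s hs.le
    _ = _ := by rw [h1]; ring

theorem integrable_indicator_exp {b c : ℝ} (hb : 0 < b) :
    Integrable (indicator (Ioi 0) fun s : ℝ => c * Real.exp (-b * s)) :=
  (integrable_indicator_iff measurableSet_Ioi).2 ((exp_neg_integrableOn_Ioi 0 hb).const_mul c)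

theorem integrable_weightedOrbit (S : StrongSemigroup H) {x : H} {σ₀ σ C B : ℝ} {φ : ℝ → ℝ}
    (hφ : Measurable φ) (hx : ∀ s, 0 ≤ s → ‖S.toFun s x‖ ≤ C * Real.exp (σ₀ * s))
    (hσ : σ₀ < σ) (hB : ∀ s, |φ s| ≤ B) : Integrable (S.weightedOrbit x σ φ) :=
  (integrable_indicator_exp (sub_pos.2 hσ)).mono'
    (S.aestronglyMeasurable_weightedOrbit x σ hφ)
    (ae_of_all _ (S.norm_weightedOrbit_le hx hB))

theorem memLp_two_weightedOrbit (S : StrongSemigroup H) {x : H} {σ₀ σ C B : ℝ} {φ : ℝ → ℝ}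
    (hφ : Measurable φ) (hx : ∀ s, 0 ≤ s → ‖S.toFun s x‖ ≤ C * Real.exp (σ₀ * s))
    (hσ : σ₀ < σ) (hB : ∀ s, |φ s| ≤ B) : MemLp (S.weightedOrbit x σ φ) 2 := by
  have hC0 : 0 ≤ C := by
    have := (norm_nonneg _).trans (hx 0 le_rfl)
    simpa using this
  have hB0 : 0 ≤ B := (abs_nonneg _).trans (hB 0)
  rw [memLp_two_iff_integrable_sq_norm (S.aestronglyMeasurable_weightedOrbit x σ hφ)]
  refine (integrable_indicator_exp (c := B * C * (B * C)) (sub_pos.2 hσ)).mono'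
    ((S.aestronglyMeasurable_weightedOrbit x σ hφ).norm.pow 2) (ae_of_all _ fun s => ?_)
  have h1 := S.norm_weightedOrbit_le (σ := σ) hx hB s
  rw [Real.norm_eq_abs, abs_of_nonneg (by positivity)]
  by_cases hs : s ∈ Ioi (0 : ℝ)
  · rw [indicator_of_mem hs] at h1 ⊢
    have hs : 0 < s := hs
    have he : Real.exp (-(σ - σ₀) * s) ≤ 1 := Real.exp_le_one_iff.2 (by nlinarith)
    have he0 := Real.exp_pos (-(σ - σ₀) * s)
    calc _ ≤ (B * C * Real.exp (-(σ - σ₀) * s)) ^ 2 := by gcongr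
      _ = B * C * (B * C) * (Real.exp (-(σ - σ₀) * s) * Real.exp (-(σ - σ₀) * s)) := by ring
      _ ≤ B * C * (B * C) * (Real.exp (-(σ - σ₀) * s) * 1) := by gcongr
      _ = _ := by ring
  · rw [indicator_of_notMem hs] at h1 ⊢
    have : ‖S.weightedOrbit x σ φ s‖ = 0 := le_antisymm h1 (norm_nonneg _)
    rw [this]; simp

open FourierTransform in
theorem fourier_weightedOrbit (S : StrongSemigroup H) (x : H) (σ : ℝ) (φ : ℝ → ℝ) (ξ : ℝ) :
    𝓕 (S.weightedOrbit x σ φ) ξ =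
      ∫ s in Ioi 0, φ s • Complex.exp (-((σ + 2 * Real.pi * ξ * Complex.I) * s)) •
        S.toFun s x := by
  rw [Real.fourier_real_eq_integral_exp_smul, ← integral_indicator measurableSet_Ioi]
  congr 1
  ext s
  by_cases hs : s ∈ Ioi (0 : ℝ)
  · rw [weightedOrbit, indicator_of_mem hs, indicator_of_mem hs, mul_smul, smul_comm,
      RCLike.real_smul_eq_coe_smul (K := ℂ) (Real.exp _), smul_smul]
    congr 2
    simp only [RCLike.ofReal_eq_complex_ofReal, Complex.ofReal_exp, ← Complex.exp_add]
    congr 1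
    push_cast
    ring
  · rw [weightedOrbit, indicator_of_notMem hs, indicator_of_notMem hs, smul_zero]

end StrongSemigroup

/-! ### The energy inequality inside the half-plane -/

namespace StrongSemigroup

variable {H : Type*} [NormedAddCommGroup H] [InnerProductSpace ℂ H]

/-- The class of multipliers `χ` on `[0, ∞[` used to localize an orbit: `χ` is continuous, vanishes
at `0`, has the right derivative `χ'` on `]0, ∞[`, and both are bounded. -/
structure IsCutoff (χ χ' : ℝ → ℝ) (B : ℝ) : Prop where
  continuous : Continuous χ
  measurable : Measurable χ'
  zero : χ 0 = 0
  bound : ∀ s, |χ s| ≤ B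
  bound_deriv : ∀ s, |χ' s| ≤ B
  hasDeriv : ∀ s, 0 < s → HasDerivWithinAt χ (χ' s) (Ioi s) s

open FourierTransform in
/-- Integration by parts against the resolvent: `(z - A)⁻¹` applied to the Laplace transform of
`χ' S(·)x` is the Laplace transform of `χ S(·)x`. -/
theorem resolvent_fourier_weightedOrbit [CompleteSpace H] (S : StrongSemigroup H)
    {x : H} {σ₀ σ C B : ℝ} {χ χ' : ℝ → ℝ}
    (hχ : IsCutoff χ χ' B) (hx : ∀ s, 0 ≤ s → ‖S.toFun s x‖ ≤ C * Real.exp (σ₀ * s))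
    (hσ : σ₀ < σ) (ξ : ℝ) {R : H →L[ℂ] H}
    (hR : S.IsResolventAt (σ + 2 * Real.pi * ξ * Complex.I) R) :
    R (𝓕 (S.weightedOrbit x σ χ') ξ) = 𝓕 (S.weightedOrbit x σ χ) ξ := by
  set z : ℂ := σ + 2 * Real.pi * ξ * Complex.I with hz
  have hzre : z.re = σ := by simp [hz]
  -- integrability of the weighted orbits, with the oscillating factor
  have hint : ∀ φ : ℝ → ℝ, Measurable φ → (∀ s, |φ s| ≤ B) →
      IntegrableOn (fun s => φ s • Complex.exp (-(z * s)) • S.toFun s x) (Ioi 0) := by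
    intro φ hφ hB
    have h1 := (integrable_indicator_iff measurableSet_Ioi).1
      (S.integrable_weightedOrbit hφ hx hσ hB)
    have hmeas : AEStronglyMeasurable (fun s : ℝ => Complex.exp (-(z * s)) • S.toFun s x)
        (volume.restrict (Ioi 0)) := by
      have hc : Continuous fun s : ℝ => Complex.exp (-(z * s)) := by fun_prop
      exact (hc.continuousOn.smul ((S.strong_cont x).mono
        Ioi_subset_Ici_self)).aestronglyMeasurable measurableSet_Ioi
    refine Integrable.mono h1 (hφ.aestronglyMeasurable.smul hmeas) (ae_of_all _ fun s => ?_)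
    rw [norm_smul, norm_smul, norm_smul, norm_mul, Complex.norm_exp, Real.norm_eq_abs,
      Real.norm_eq_abs, Real.abs_exp, mul_assoc]
    simp [hzre]
  have hχm := hχ.continuous.measurable
  rw [fourier_weightedOrbit, fourier_weightedOrbit, ← R.integral_comp_comm
    (hint χ' hχ.measurable hχ.bound_deriv)]
  set h : ℝ → H := fun s => Complex.exp (-(z * s)) • S.toFun s (R x) with hh
  have hdh : ∀ s, 0 < s → HasDerivWithinAt h (-z • h s + Complex.exp (-(z * s)) •
      S.toFun s (z • R x - x)) (Ioi s) s := by
    intro s hs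
    have e1 : HasDerivAt (fun s : ℝ => Complex.exp (-(z * s)))
        (Complex.exp (-(z * s)) * -(z * 1)) s :=
      ((Complex.ofRealCLM.hasDerivAt.const_mul z).neg).cexp
    have := e1.hasDerivWithinAt.smul ((hR.2 x).hasDerivWithinAt hs.le)
    refine this.congr_deriv ?_
    simp only [hh, smul_smul]
    rw [add_comm]
    congr 2
    ring
  have hdk : ∀ s, 0 < s → HasDerivWithinAt (fun s => χ s • h s)
      (χ' s • h s - χ s • Complex.exp (-(z * s)) • S.toFun s x) (Ioi s) s := by
    intro s hs
    refine ((hχ.hasDeriv s hs).smul (hdh s hs)).congr_deriv ?_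
    simp only [hh, map_sub, map_smul, smul_sub, smul_add, neg_smul]
    rw [smul_comm (Complex.exp _) z]
    module
  have hRS : ∀ s : ℝ, 0 ≤ s → h s = R (Complex.exp (-(z * s)) • S.toFun s x) := by
    intro s hs
    rw [map_smul, hR.commute hs]
  have hi1 : IntegrableOn (fun s => χ' s • h s) (Ioi 0) := by
    refine (R.integrable_comp (hint χ' hχ.measurable hχ.bound_deriv)).congr ?_
    filter_upwards [ae_restrict_mem measurableSet_Ioi] with s hs
    rw [hRS s (le_of_lt hs), ContinuousLinearMap.map_smul_of_tower]
  have hi2 := hint χ hχm hχ.bound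
  have hkc : ContinuousOn (fun s => χ s • h s) (Ici 0) := by
    refine hχ.continuous.continuousOn.smul (ContinuousOn.smul ?_ (S.strong_cont _))
    exact Continuous.continuousOn (by fun_prop)
  have hftc : ∀ T : ℝ, 0 ≤ T → ∫ s in (0 : ℝ)..T, (χ' s • h s -
      χ s • Complex.exp (-(z * s)) • S.toFun s x) = χ T • h T := by
    intro T hT
    rw [intervalIntegral.integral_eq_sub_of_hasDeriv_right_of_le hT
      (hkc.mono Icc_subset_Ici_self) (fun s hs => hdk s hs.1)]
    · simp [hχ.zero]
    · rw [intervalIntegrable_iff_integrableOn_Ioc_of_le hT]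
      exact (hi1.sub hi2).mono_set Ioc_subset_Ioi_self
  have hlim := intervalIntegral_tendsto_integral_Ioi 0 (hi1.sub hi2) tendsto_id
  have hlim0 : Tendsto (fun T => ∫ s in (0 : ℝ)..T, (χ' s • h s -
      χ s • Complex.exp (-(z * s)) • S.toFun s x)) atTop (𝓝 0) := by
    have hexp : Tendsto (fun T : ℝ => B * (‖R‖ * C) * Real.exp (-((σ - σ₀) * T))) atTop (𝓝 0) := by
      rw [show (0 : ℝ) = B * (‖R‖ * C) * 0 by simp]
      refine Tendsto.const_mul _ (Real.tendsto_exp_neg_atTop_nhds_zero.comp ?_)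
      exact tendsto_id.const_mul_atTop (sub_pos.2 hσ)
    refine squeeze_zero_norm' ?_ hexp
    filter_upwards [eventually_ge_atTop 0] with T hT
    rw [hftc T hT, hRS T hT, norm_smul]
    have hB0 : 0 ≤ B := (abs_nonneg _).trans (hχ.bound 0)
    have h1 : ‖R (Complex.exp (-(z * T)) • S.toFun T x)‖ ≤
        ‖R‖ * (Real.exp (-(σ * T)) * (C * Real.exp (σ₀ * T))) := by
      refine (R.le_opNorm _).trans ?_
      rw [norm_smul, Complex.norm_exp]
      have : (-(z * T)).re = -(σ * T) := by simp [hzre]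
      rw [this]
      gcongr
      exact hx T hT
    have h2 : Real.exp (-((σ - σ₀) * T)) = Real.exp (-(σ * T)) * Real.exp (σ₀ * T) := by
      rw [← Real.exp_add]; congr 1; ring
    calc _ ≤ B * (‖R‖ * (Real.exp (-(σ * T)) * (C * Real.exp (σ₀ * T)))) :=
          mul_le_mul (hχ.bound T) h1 (norm_nonneg _) hB0
      _ = _ := by rw [h2]; ring
  have h0 := tendsto_nhds_unique hlim hlim0
  simp only [Pi.sub_apply] at h0
  rw [integral_sub hi1 hi2, sub_eq_zero] at h0
  rw [← h0]
  refine setIntegral_congr_fun measurableSet_Ioi fun s hs => ?_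
  rw [hRS s (le_of_lt hs), ContinuousLinearMap.map_smul_of_tower]

theorem integrable_weighted_sq (S : StrongSemigroup H) {x : H} {σ₀ σ C B : ℝ} {φ : ℝ → ℝ}
    (hφ : Measurable φ) (hx : ∀ s, 0 ≤ s → ‖S.toFun s x‖ ≤ C * Real.exp (σ₀ * s))
    (hσ : σ₀ < σ) (hB : ∀ s, |φ s| ≤ B) :
    IntegrableOn (fun s => φ s ^ 2 * (Real.exp (-(σ * s)) * ‖S.toFun s x‖) ^ 2) (Ioi 0) ∧
    ∫ s, ‖S.weightedOrbit x σ φ s‖ ^ 2 =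
      ∫ s in Ioi 0, φ s ^ 2 * (Real.exp (-(σ * s)) * ‖S.toFun s x‖) ^ 2 := by
  have h1 := (memLp_two_iff_integrable_sq_norm (S.aestronglyMeasurable_weightedOrbit x σ hφ)).1
    (S.memLp_two_weightedOrbit hφ hx hσ hB)
  have h2 : (fun s => ‖S.weightedOrbit x σ φ s‖ ^ 2) =
      indicator (Ioi 0) fun s => φ s ^ 2 * (Real.exp (-(σ * s)) * ‖S.toFun s x‖) ^ 2 := by
    ext s
    by_cases hs : s ∈ Ioi (0 : ℝ)
    · rw [weightedOrbit, indicator_of_mem hs, indicator_of_mem hs, norm_smul, norm_mul,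
        Real.norm_eq_abs, Real.norm_eq_abs, Real.abs_exp, mul_assoc, mul_pow, sq_abs]
    · rw [weightedOrbit, indicator_of_notMem hs, indicator_of_notMem hs]; simp
  rw [h2] at h1 ⊢
  exact ⟨(integrable_indicator_iff measurableSet_Ioi).1 h1, integral_indicator measurableSet_Ioi⟩

open FourierTransform in
/-- The resolvent bound on the line `Re z = σ`, transported to the time side by Plancherel's theorem. -/
theorem resolvent_energy_inequality [CompleteSpace H] {S : StrongSemigroup H} {ω r : ℝ}
    (hr : S.HasResolventRadius ω r) {x : H} {σ₀ σ C B : ℝ} {χ χ' : ℝ → ℝ}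
    (hχ : IsCutoff χ χ' B) (hx : ∀ s, 0 ≤ s → ‖S.toFun s x‖ ≤ C * Real.exp (σ₀ * s))
    (hσ : σ₀ < σ) (hω : ω < σ) :
    r ^ 2 * ∫ s in Ioi 0, χ s ^ 2 * (Real.exp (-(σ * s)) * ‖S.toFun s x‖) ^ 2 ≤
      ∫ s in Ioi 0, χ' s ^ 2 * (Real.exp (-(σ * s)) * ‖S.toFun s x‖) ^ 2 := by
  have hχm := hχ.continuous.measurable
  have hr0 := hr.1
  rw [← (S.integrable_weighted_sq hχm hx hσ hχ.bound).2,
    ← (S.integrable_weighted_sq hχ.measurable hx hσ hχ.bound_deriv).2]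
  obtain ⟨hf, hf'⟩ := plancherel_of_integrable (S.integrable_weightedOrbit hχm hx hσ hχ.bound)
    (S.memLp_two_weightedOrbit hχm hx hσ hχ.bound)
  obtain ⟨hg, hg'⟩ := plancherel_of_integrable
    (S.integrable_weightedOrbit hχ.measurable hx hσ hχ.bound_deriv)
    (S.memLp_two_weightedOrbit hχ.measurable hx hσ hχ.bound_deriv)
  rw [← hf', ← hg', ← integral_const_mul]
  refine integral_mono (((memLp_two_iff_integrable_sq_norm hf.1).1 hf).const_mul _)
    ((memLp_two_iff_integrable_sq_norm hg.1).1 hg) fun ξ => ?_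
  have hz : ω < (σ + 2 * Real.pi * ξ * Complex.I : ℂ).re := by simpa using hω
  obtain ⟨R, hR⟩ := hr.2.1 _ hz
  have h1 := hr.norm_le hz hR
  simp only
  rw [← S.resolvent_fourier_weightedOrbit hχ hx hσ ξ hR, ← mul_pow]
  have h2 := (R.le_opNorm (𝓕 (S.weightedOrbit x σ χ') ξ)).trans
    (mul_le_mul_of_nonneg_right h1 (norm_nonneg _))
  gcongr
  calc _ ≤ r * (1 / r * ‖𝓕 (S.weightedOrbit x σ χ') ξ‖) := by gcongr
    _ = _ := by field_simp

end StrongSemigroup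

/-! ### Exponential decay and the energy inequality on the boundary line -/

namespace StrongSemigroup

variable {H : Type*} [NormedAddCommGroup H] [InnerProductSpace ℂ H]

theorem isCutoff_exp_min_sub_one {δ N : ℝ} (hδ : 0 < δ) (hN : 0 ≤ N) :
    IsCutoff (fun s => Real.exp (δ * min (max s 0) N) - 1)
      (fun s => if s < N then δ * Real.exp (δ * s) else 0) ((1 + δ) * Real.exp (δ * N)) where
  continuous := by fun_prop
  measurable := Measurable.ite measurableSet_Iio (by fun_prop) measurable_const
  zero := by simp [hN]
  bound s := by
    have h1 : 0 ≤ min (max s 0) N := le_min (le_max_right _ _) hN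
    have h2 : Real.exp (δ * min (max s 0) N) ≤ Real.exp (δ * N) :=
      Real.exp_le_exp.2 (mul_le_mul_of_nonneg_left (min_le_right _ _) hδ.le)
    have h3 := Real.one_le_exp (mul_nonneg hδ.le h1)
    rw [abs_of_nonneg (by linarith)]
    nlinarith [Real.exp_pos (δ * N)]
  bound_deriv s := by
    have h0 := Real.exp_pos (δ * N)
    split_ifs with h
    · have h2 : Real.exp (δ * s) ≤ Real.exp (δ * N) :=
        Real.exp_le_exp.2 (mul_le_mul_of_nonneg_left h.le hδ.le)
      rw [abs_of_nonneg (by positivity)]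
      nlinarith
    · simp only [abs_zero]; positivity
  hasDeriv s hs := by
    split_ifs with h
    · have h1 : HasDerivAt (fun s => Real.exp (δ * s) - 1) (δ * Real.exp (δ * s)) s := by
        have := (((hasDerivAt_id s).const_mul δ).exp).sub_const 1
        refine this.congr_deriv ?_
        simp [mul_comm]
      refine h1.hasDerivWithinAt.congr_of_eventuallyEq ?_ ?_
      · filter_upwards [Ioo_mem_nhdsGT h] with u hu
        rw [max_eq_left (hs.trans hu.1).le, min_eq_left hu.2.le]
      · rw [max_eq_left hs.le, min_eq_left h.le]
    · have h : N ≤ s := not_lt.1 h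
      refine (hasDerivWithinAt_const s (Ioi s) (Real.exp (δ * N) - 1)).congr_of_eventuallyEq ?_ ?_
      · filter_upwards [self_mem_nhdsWithin] with u hu
        have hu : s < u := hu
        rw [max_eq_left (hs.trans hu).le, min_eq_right (h.trans hu.le)]
      · rw [max_eq_left hs.le, min_eq_right h]

/-- The self-improvement of exponential decay rates: the energy inequality for the multipliers
`e^{δ min(s, N)} - 1`, uniformly in `N`, lowers the exponential rate of an orbit. -/
theorem orbit_decay_step [CompleteSpace H] {S : StrongSemigroup H} {ω r : ℝ}
    (hr : S.HasResolventRadius ω r) {K : ℝ} (hK : ∀ t ∈ Icc (0 : ℝ) 1, ‖S.toFun t‖ ≤ K)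
    {x : H} {σ₀ C : ℝ} (hx : ∀ s, 0 ≤ s → ‖S.toFun s x‖ ≤ C * Real.exp (σ₀ * s)) :
    ∃ C' : ℝ, ∀ s, 0 ≤ s → ‖S.toFun s x‖ ≤ C' * Real.exp ((max σ₀ ω - r / 4) * s) := by
  have hr0 : 0 < r := hr.1
  set σ := max σ₀ ω + r / 4 with hσdef
  set δ := r / 2 with hδdef
  have hδ : 0 < δ := by positivity
  have hσ : σ₀ < σ := (le_max_left σ₀ ω).trans_lt (by linarith)
  have hω : ω < σ := (le_max_right σ₀ ω).trans_lt (by linarith)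
  have hrate : max σ₀ ω - r / 4 = σ - δ := by rw [hσdef, hδdef]; ring
  rw [hrate]
  set W : ℝ → ℝ := fun s => (Real.exp (-(σ * s)) * ‖S.toFun s x‖) ^ 2 with hW
  have hWi : IntegrableOn W (Ioi 0) := by
    have := (S.integrable_weighted_sq (φ := fun _ => 1) (B := 1) measurable_const hx hσ
      (by simp)).1
    simpa using this
  set I := ∫ s in Ioi 0, W s with hI
  have hI0 : 0 ≤ I := setIntegral_nonneg measurableSet_Ioi fun s _ => by positivity
  -- the bound of the localized energy, uniform in `N`
  have henergy : ∀ N : ℝ, 0 ≤ N → IntegrableOn (fun s =>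
      (Real.exp (δ * min (max s 0) N) - 1) ^ 2 * W s) (Ioi 0) ∧
      ∫ s in Ioi 0, (Real.exp (δ * min (max s 0) N) - 1) ^ 2 * W s ≤ I := by
    intro N hN
    have hc := isCutoff_exp_min_sub_one hδ hN
    have h1 := resolvent_energy_inequality hr hc hx hσ hω
    have h2 := (S.integrable_weighted_sq hc.continuous.measurable hx hσ hc.bound).1
    have h3 := (S.integrable_weighted_sq hc.measurable hx hσ hc.bound_deriv).1
    refine ⟨h2, ?_⟩
    have h4 : ∫ s in Ioi 0, (if s < N then δ * Real.exp (δ * s) else 0) ^ 2 * W s ≤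
        ∫ s in Ioi 0, (2 * δ ^ 2 * ((Real.exp (δ * min (max s 0) N) - 1) ^ 2 * W s) +
          2 * δ ^ 2 * W s) := by
      refine setIntegral_mono_on h3 ((h2.const_mul _).add (hWi.const_mul _)) measurableSet_Ioi ?_
      intro s hs
      have hs : 0 < s := hs
      have hW0 : 0 ≤ W s := by positivity
      rw [← mul_assoc, ← add_mul]
      refine mul_le_mul_of_nonneg_right ?_ hW0
      split_ifs with h
      · rw [max_eq_left hs.le, min_eq_left h.le]
        nlinarith [sq_nonneg (δ * (Real.exp (δ * s) - 2))]
      · have : 0 ≤ (Real.exp (δ * min (max s 0) N) - 1) ^ 2 := sq_nonneg _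
        nlinarith [sq_nonneg δ, mul_nonneg (sq_nonneg δ) this]
    rw [integral_add (h2.const_mul _) (hWi.const_mul _), integral_const_mul,
      integral_const_mul] at h4
    have h5 := h1.trans h4
    have h6 : 2 * δ ^ 2 = r ^ 2 / 2 := by rw [hδdef]; ring
    rw [h6] at h5
    have h7 : 0 < r ^ 2 := by positivity
    nlinarith
  have hK1 : 0 ≤ K := (norm_nonneg _).trans (hK 0 ⟨le_rfl, zero_le_one⟩)
  set T := 1 + 1 / δ with hT
  have hT0 : 0 < T := by positivity
  have hC0 : 0 ≤ C := by simpa using (norm_nonneg _).trans (hx 0 le_rfl)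
  -- for `t ≥ T`, the energy in `[t - 1, t]` controls `S(t) x`
  have hlarge : ∀ t, T ≤ t → ‖S.toFun t x‖ ≤
      (K * 2 * Real.exp (|σ - δ|) * √I) * Real.exp ((σ - δ) * t) := by
    intro t ht
    have hδt : 1 / δ ≤ t - 1 := by linarith
    have hδ1 : 0 < 1 / δ := by positivity
    obtain ⟨hi, hle⟩ := henergy t (by linarith)
    have hpt : ∀ s ∈ Ioc (t - 1) t, ‖S.toFun t x‖ ^ 2 ≤
        (K * 2 * Real.exp (|σ - δ|) * Real.exp ((σ - δ) * t)) ^ 2 *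
          ((Real.exp (δ * min (max s 0) t) - 1) ^ 2 * W s) := by
      intro s hs
      have hs0 : 0 < s := by linarith [hs.1]
      have hSt : ‖S.toFun t x‖ ≤ K * ‖S.toFun s x‖ := by
        have e1 := congrArg (fun A => A x) (S.map_add (t - s) s (by linarith [hs.2]) hs0.le)
        simp only [ContinuousLinearMap.comp_apply, sub_add_cancel] at e1
        rw [e1]
        exact ((S.toFun (t - s)).le_opNorm _).trans (mul_le_mul_of_nonneg_right
          (hK _ ⟨by linarith [hs.2], by linarith [hs.1]⟩) (norm_nonneg _))
      have hexp2 : 2 ≤ Real.exp (δ * s) := by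
        have : 1 ≤ δ * s := by
          have : δ * (1 / δ) ≤ δ * s := mul_le_mul_of_nonneg_left (by linarith [hs.1]) hδ.le
          rwa [mul_one_div_cancel hδ.ne'] at this
        linarith [Real.add_one_le_exp (δ * s)]
      rw [max_eq_left hs0.le, min_eq_left hs.2, hW, ← mul_pow, ← mul_pow]
      have h1 : 1 ≤ 2 * Real.exp |σ - δ| * Real.exp ((σ - δ) * t) *
          ((Real.exp (δ * s) - 1) * Real.exp (-(σ * s))) := by
        have h2 : 1 ≤ Real.exp |σ - δ| * Real.exp ((σ - δ) * t) *
            (Real.exp (δ * s) * Real.exp (-(σ * s))) := by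
          rw [← Real.exp_add, ← Real.exp_add, ← Real.exp_add]
          refine Real.one_le_exp ?_
          have h3 : |(σ - δ) * (t - s)| ≤ |σ - δ| * 1 := by
            rw [abs_mul]
            refine mul_le_mul_of_nonneg_left ?_ (abs_nonneg _)
            rw [abs_le]
            constructor <;> linarith [hs.1, hs.2]
          have := neg_abs_le ((σ - δ) * (t - s))
          nlinarith
        refine h2.trans ?_
        have h4 : Real.exp (δ * s) ≤ 2 * (Real.exp (δ * s) - 1) := by linarith
        calc _ ≤ Real.exp |σ - δ| * Real.exp ((σ - δ) * t) *
              (2 * (Real.exp (δ * s) - 1) * Real.exp (-(σ * s))) := by gcongr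
          _ = _ := by ring
      refine pow_le_pow_left₀ (norm_nonneg _) ?_ 2
      calc ‖S.toFun t x‖ ≤ 1 * (K * ‖S.toFun s x‖) := by rw [one_mul]; exact hSt
        _ ≤ (2 * Real.exp |σ - δ| * Real.exp ((σ - δ) * t) *
          ((Real.exp (δ * s) - 1) * Real.exp (-(σ * s)))) * (K * ‖S.toFun s x‖) := by gcongr
        _ = _ := by ring
    have hsub : Ioc (t - 1) t ⊆ Ioi 0 := fun s hs => by
      have := hs.1
      simp only [mem_Ioi]; linarith
    have h1 := setIntegral_mono_on (μ := volume) (f := fun _ => ‖S.toFun t x‖ ^ 2)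
      (by simp) ((hi.mono_set hsub).const_mul _) measurableSet_Ioc hpt
    rw [integral_const_mul] at h1
    simp only [integral_const, MeasurableSet.univ, measureReal_restrict_apply, univ_inter,
      Real.volume_real_Ioc, sub_sub_cancel, zero_le_one, sup_of_le_left, smul_eq_mul, one_mul] at h1
    have h2 := setIntegral_mono_set hi (ae_of_all _ fun s => by
      simp only [Pi.zero_apply]; positivity) hsub.eventuallyLE
    have h3 : ‖S.toFun t x‖ ^ 2 ≤
        ((K * 2 * Real.exp (|σ - δ|) * √I) * Real.exp ((σ - δ) * t)) ^ 2 := by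
      refine h1.trans ((mul_le_mul_of_nonneg_left (h2.trans hle) (sq_nonneg _)).trans_eq ?_)
      calc _ = (K * 2 * Real.exp |σ - δ| * Real.exp ((σ - δ) * t)) ^ 2 * √I ^ 2 := by
            rw [Real.sq_sqrt hI0]
        _ = _ := by ring
    exact le_of_sq_le_sq h3 (by positivity)
  refine ⟨K * 2 * Real.exp (|σ - δ|) * √I + C * Real.exp (|σ₀ - (σ - δ)| * T), fun t ht => ?_⟩
  rw [add_mul]
  rcases le_total T t with h | h
  · exact (hlarge t h).trans (le_add_of_nonneg_right (by positivity))
  · refine (hx t ht).trans ((?_ : _ ≤ _).trans (le_add_of_nonneg_left (by positivity)))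
    rw [mul_assoc, ← Real.exp_add]
    refine mul_le_mul_of_nonneg_left (Real.exp_le_exp.2 ?_) hC0
    have h1 : (σ₀ - (σ - δ)) * t ≤ |σ₀ - (σ - δ)| * T :=
      mul_le_mul (le_abs_self _) h ht (abs_nonneg _)
    linarith

/-- Every orbit decays at an exponential rate strictly smaller than `ω`. -/
theorem exists_orbit_decay [CompleteSpace H] {S : StrongSemigroup H} {ω r : ℝ}
    (hr : S.HasResolventRadius ω r) {m : ℝ → ℝ} (hm : ContinuousOn m (Ici 0))
    (hS : ∀ t : ℝ, 0 < t → ‖S.toFun t‖ ≤ m t) (x : H) :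
    ∃ σ₀ C : ℝ, σ₀ < ω ∧ ∀ s, 0 ≤ s → ‖S.toFun s x‖ ≤ C * Real.exp (σ₀ * s) := by
  have hr0 := hr.1
  obtain ⟨C₁, γ, hC₁, hb⟩ := S.exists_exp_bound hm hS
  have hK : ∀ t ∈ Icc (0 : ℝ) 1, ‖S.toFun t‖ ≤ C₁ * Real.exp |γ| := fun t ht =>
    (hb t ht.1).trans (mul_le_mul_of_nonneg_left (Real.exp_le_exp.2 (by
      calc γ * t ≤ |γ| * 1 := mul_le_mul (le_abs_self _) ht.2 ht.1 (abs_nonneg _)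
        _ = |γ| := mul_one _)) hC₁)
  have hn : ∀ n : ℕ, ∃ C : ℝ, ∀ s, 0 ≤ s →
      ‖S.toFun s x‖ ≤ C * Real.exp (max (γ - n * (r / 4)) (ω - r / 4) * s) := by
    intro n
    induction n with
    | zero =>
      refine ⟨C₁ * ‖x‖, fun s hs => ?_⟩
      refine ((S.toFun s).le_opNorm x).trans ?_
      calc ‖S.toFun s‖ * ‖x‖ ≤ C₁ * Real.exp (γ * s) * ‖x‖ := by gcongr; exact hb s hs
        _ = C₁ * ‖x‖ * Real.exp (γ * s) := by ring
        _ ≤ _ := by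
          gcongr
          simp
    | succ k ih =>
      obtain ⟨C, hC⟩ := ih
      obtain ⟨C', hC'⟩ := orbit_decay_step hr hK hC
      refine ⟨C', fun s hs => ?_⟩
      have : max (γ - (k + 1 : ℕ) * (r / 4)) (ω - r / 4) =
          max (max (γ - k * (r / 4)) (ω - r / 4)) ω - r / 4 := by
        rw [max_assoc, max_eq_right (by linarith : ω - r / 4 ≤ ω), ← max_sub_sub_right]
        congr 1
        push_cast
        ring
      rw [this]
      exact hC' s hs
  obtain ⟨n, hn'⟩ := exists_nat_gt ((γ - ω) / (r / 4))
  obtain ⟨C, hC⟩ := hn n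
  refine ⟨_, C, ?_, hC⟩
  rw [div_lt_iff₀ (by positivity)] at hn'
  exact max_lt (by linarith) (by linarith)

/-- The energy inequality on the boundary line `Re z = ω` of the half-plane. -/
theorem energy_inequality [CompleteSpace H] {S : StrongSemigroup H} {ω r : ℝ}
    (hr : S.HasResolventRadius ω r) {m : ℝ → ℝ} (hm : ContinuousOn m (Ici 0))
    (hS : ∀ t : ℝ, 0 < t → ‖S.toFun t‖ ≤ m t) (x : H) {χ χ' : ℝ → ℝ} {B : ℝ}
    (hχ : IsCutoff χ χ' B) :
    IntegrableOn (fun s => (r ^ 2 * χ s ^ 2 - χ' s ^ 2) *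
      (Real.exp (-(ω * s)) * ‖S.toFun s x‖) ^ 2) (Ioi 0) ∧
    ∫ s in Ioi 0, (r ^ 2 * χ s ^ 2 - χ' s ^ 2) *
      (Real.exp (-(ω * s)) * ‖S.toFun s x‖) ^ 2 ≤ 0 := by
  obtain ⟨σ₀, C, hσ₀, hx⟩ := exists_orbit_decay hr hm hS x
  have hχm := hχ.continuous.measurable
  set F : ℝ → ℝ → ℝ := fun σ s => (r ^ 2 * χ s ^ 2 - χ' s ^ 2) *
      (Real.exp (-(σ * s)) * ‖S.toFun s x‖) ^ 2 with hF
  have hi1 : ∀ σ, σ₀ < σ → _ := fun σ hσ =>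
    (S.integrable_weighted_sq hχm hx hσ hχ.bound).1
  have hi2 : ∀ σ, σ₀ < σ → _ := fun σ hσ =>
    (S.integrable_weighted_sq hχ.measurable hx hσ hχ.bound_deriv).1
  have hFi : ∀ σ, σ₀ < σ → IntegrableOn (F σ) (Ioi 0) := by
    intro σ hσ
    refine (((hi1 σ hσ).const_mul (r ^ 2)).sub (hi2 σ hσ)).congr (ae_of_all _ fun s => ?_)
    simp only [hF, Pi.sub_apply]; ring
  have hFle : ∀ σ, ω < σ → ∫ s in Ioi 0, F σ s ≤ 0 := by
    intro σ hσ
    have h1 := resolvent_energy_inequality hr hχ hx (hσ₀.trans hσ) hσ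
    have h2 : ∫ s in Ioi 0, F σ s = r ^ 2 * (∫ s in Ioi 0, χ s ^ 2 *
        (Real.exp (-(σ * s)) * ‖S.toFun s x‖) ^ 2) - ∫ s in Ioi 0, χ' s ^ 2 *
        (Real.exp (-(σ * s)) * ‖S.toFun s x‖) ^ 2 := by
      rw [← integral_const_mul, ← integral_sub ((hi1 σ (hσ₀.trans hσ)).const_mul (r ^ 2))
        (hi2 σ (hσ₀.trans hσ))]
      congr 1
      ext s
      simp only [hF]; ring
    linarith
  refine ⟨hFi ω hσ₀, ?_⟩
  have hlim : Tendsto (fun σ => ∫ s in Ioi 0, F σ s) (𝓝[>] ω) (𝓝 (∫ s in Ioi 0, F ω s)) := by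
    refine tendsto_integral_filter_of_dominated_convergence (fun s => |F ω s|) ?_ ?_
      (hFi ω hσ₀).abs ?_
    · filter_upwards [self_mem_nhdsWithin] with σ hσ
      exact (hFi σ (hσ₀.trans hσ)).1
    · filter_upwards [self_mem_nhdsWithin] with σ hσ
      filter_upwards [ae_restrict_mem measurableSet_Ioi] with s hs
      have hs : 0 < s := hs
      have hσ : ω < σ := hσ
      simp only [hF, Real.norm_eq_abs, abs_mul]
      gcongr
    · refine ae_of_all _ fun s => ?_
      refine (Continuous.tendsto ?_ ω).mono_left nhdsWithin_le_nhds
      simp only [hF]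
      fun_prop
  refine le_of_tendsto hlim ?_
  filter_upwards [self_mem_nhdsWithin] with σ hσ
  exact hFle σ hσ

end StrongSemigroup

/-! ### The Sturm–Liouville flow -/

/-- The Sturm–Liouville system `u' = φ(p) / N`, `p' = -k N u` on `[0, b]`. For `φ = id` and
`N = m²` it is the phase space form of `(m² u')' + k m² u = 0`, with `p = m² u'`. The choice
`φ(p) = max p 0` freezes `u` as soon as `p` becomes negative. -/
def IsFlow (φ N : ℝ → ℝ) (k b : ℝ) (u p : ℝ → ℝ) : Prop :=
  ∀ s ∈ Icc 0 b, HasDerivWithinAt u (φ (p s) / N s) (Icc 0 b) s ∧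
    HasDerivWithinAt p (-(k * N s * u s)) (Icc 0 b) s

theorem monotoneOn_Icc_of_hasDerivWithinAt {g g' : ℝ → ℝ} {a b c d : ℝ}
    (hsub : Icc a b ⊆ Icc c d)
    (hd : ∀ s ∈ Icc a b, HasDerivWithinAt g (g' s) (Icc c d) s) (h0 : ∀ s ∈ Icc a b, 0 ≤ g' s) :
    MonotoneOn g (Icc a b) :=
  monotoneOn_of_hasDerivWithinAt_nonneg (convex_Icc a b)
    (fun s hs => ((hd s hs).mono hsub).continuousWithinAt)
    (fun s hs => (hd s (interior_subset hs)).mono (interior_subset.trans hsub))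
    (fun s hs => h0 s (interior_subset hs))

namespace IsFlow

variable {φ N : ℝ → ℝ} {k b : ℝ} {u p : ℝ → ℝ}

theorem mono (h : IsFlow φ N k b u p) {c : ℝ} (hc : c ≤ b) : IsFlow φ N k c u p := fun s hs =>
  ⟨(h s ⟨hs.1, hs.2.trans hc⟩).1.mono (Icc_subset_Icc_right hc),
    (h s ⟨hs.1, hs.2.trans hc⟩).2.mono (Icc_subset_Icc_right hc)⟩

theorem congr (h : IsFlow φ N k b u p) {u' p' : ℝ → ℝ} (hu : ∀ s ∈ Icc 0 b, u' s = u s)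
    (hp : ∀ s ∈ Icc 0 b, p' s = p s) : IsFlow φ N k b u' p' := fun s hs => by
  rw [hu s hs, hp s hs]
  exact ⟨(h s hs).1.congr hu (hu s hs), (h s hs).2.congr hp (hp s hs)⟩

theorem continuousOn_fst (h : IsFlow φ N k b u p) : ContinuousOn u (Icc 0 b) :=
  fun s hs => (h s hs).1.continuousWithinAt

theorem continuousOn_snd (h : IsFlow φ N k b u p) : ContinuousOn p (Icc 0 b) :=
  fun s hs => (h s hs).2.continuousWithinAt

/-- Grönwall's estimate for the dependence of the flow on the parameter `k`. -/
theorem dist_le (h : IsFlow φ N k b u p) {k' : ℝ} {u' p' : ℝ → ℝ} (h' : IsFlow φ N k' b u' p')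
    (hφ : LipschitzWith 1 φ) (hN : ∀ s ∈ Icc 0 b, 0 < N s) {K : NNReal} {ε : ℝ}
    (hK : ∀ s ∈ Icc 0 b, 1 / N s ≤ K ∧ |k| * N s ≤ K)
    (hε : ∀ s ∈ Icc 0 b, |k - k'| * N s * |u' s| ≤ ε)
    (hu : u 0 = u' 0) (hp : p 0 = p' 0) :
    ∀ s ∈ Icc 0 b, dist (u s, p s) (u' s, p' s) ≤ gronwallBound 0 K ε s := by
  intro s hs
  have key := dist_le_of_approx_trajectories_ODE_of_mem
    (v := fun t (x : ℝ × ℝ) => (φ x.2 / N t, -(k * N t * x.1)))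
    (s := fun _ => univ) (K := K) (a := 0) (b := b) (δ := 0) (εf := 0) (εg := ε)
    (f := fun t => (u t, p t)) (f' := fun t => (φ (p t) / N t, -(k * N t * u t)))
    (g := fun t => (u' t, p' t)) (g' := fun t => (φ (p' t) / N t, -(k' * N t * u' t)))
    ?_ (h.continuousOn_fst.prodMk h.continuousOn_snd) ?_ ?_ (fun _ _ => mem_univ _)
    (h'.continuousOn_fst.prodMk h'.continuousOn_snd) ?_ ?_ (fun _ _ => mem_univ _) ?_ s hs
  · simpa using key
  · intro t ht
    have ht : t ∈ Icc 0 b := Ico_subset_Icc_self ht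
    refine (LipschitzWith.of_dist_le_mul fun x y => ?_).lipschitzOnWith
    obtain ⟨h1, h2⟩ := hK t ht
    have hNt := hN t ht
    rw [Prod.dist_eq, Prod.dist_eq]
    have hx := le_max_left (dist x.1 y.1) (dist x.2 y.2)
    have hy := le_max_right (dist x.1 y.1) (dist x.2 y.2)
    refine max_le ?_ ?_
    · have h3 := hφ.dist_le_mul x.2 y.2
      rw [NNReal.coe_one, one_mul, Real.dist_eq] at h3
      simp only [Real.dist_eq] at hx hy h3 ⊢
      rw [← sub_div, abs_div, abs_of_pos hNt, div_eq_mul_one_div, mul_comm]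
      exact mul_le_mul h1 (h3.trans hy) (abs_nonneg _) K.2
    · simp only [Real.dist_eq] at hx hy ⊢
      rw [show -(k * N t * x.1) - -(k * N t * y.1) = -(k * N t * (x.1 - y.1)) by ring, abs_neg,
        abs_mul, abs_mul, abs_of_pos hNt]
      exact mul_le_mul h2 hx (abs_nonneg _) K.2
  · intro t ht
    have := h t (Ico_subset_Icc_self ht)
    exact (this.1.prodMk this.2).mono_of_mem_nhdsWithin (Icc_mem_nhdsGE_of_mem ht)
  · intro t ht; simp
  · intro t ht
    have := h' t (Ico_subset_Icc_self ht)
    exact (this.1.prodMk this.2).mono_of_mem_nhdsWithin (Icc_mem_nhdsGE_of_mem ht)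
  · intro t ht
    have ht : t ∈ Icc 0 b := Ico_subset_Icc_self ht
    have h1 := hε t ht
    rw [Prod.dist_eq]
    refine max_le ?_ ?_
    · rw [dist_self]
      exact le_trans (mul_nonneg (mul_nonneg (abs_nonneg _) (hN t ht).le) (abs_nonneg _)) h1
    · rw [Real.dist_eq, show -(k' * N t * u' t) - -(k * N t * u' t) = (k - k') * N t * u' t by ring,
        abs_mul, abs_mul, abs_of_pos (hN t ht)]
      exact h1
  · simp [hu, hp]

end IsFlow

/-- A common Lipschitz constant on `[0, b]` of the flows with parameter `|k| ≤ k₁`. -/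
theorem exists_flow_bound {N : ℝ → ℝ} {b : ℝ} (hNc : ContinuousOn N (Icc 0 b))
    (hN : ∀ s ∈ Icc 0 b, 0 < N s) (k₁ : ℝ) :
    ∃ K : NNReal, ∀ k, |k| ≤ k₁ → ∀ s ∈ Icc 0 b, 1 / N s ≤ K ∧ |k| * N s ≤ K := by
  obtain ⟨B₁, hB₁⟩ := isCompact_Icc.bddAbove_image hNc
  obtain ⟨B₂, hB₂⟩ := isCompact_Icc.bddAbove_image
    (continuousOn_const.div hNc fun s hs => (hN s hs).ne' : ContinuousOn (fun s => 1 / N s) _)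
  refine ⟨Real.toNNReal (max B₂ (k₁ * B₁)), fun k hk s hs => ?_⟩
  have h1 : N s ≤ B₁ := hB₁ (mem_image_of_mem N hs)
  have h2 : 1 / N s ≤ B₂ := hB₂ (mem_image_of_mem (fun s => 1 / N s) hs)
  have h3 := Real.le_coe_toNNReal (max B₂ (k₁ * B₁))
  refine ⟨(h2.trans (le_max_left _ _)).trans h3, (le_trans ?_ (le_max_right _ _)).trans h3⟩
  exact mul_le_mul hk h1 (hN s hs).le ((abs_nonneg k).trans hk)

theorem IsFlow.unique {φ N : ℝ → ℝ} {k b : ℝ} {u p u' p' : ℝ → ℝ} (h : IsFlow φ N k b u p)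
    (h' : IsFlow φ N k b u' p') (hφ : LipschitzWith 1 φ) (hNc : ContinuousOn N (Icc 0 b))
    (hN : ∀ s ∈ Icc 0 b, 0 < N s) (hu : u 0 = u' 0) (hp : p 0 = p' 0) :
    ∀ s ∈ Icc 0 b, u s = u' s ∧ p s = p' s := by
  intro s hs
  obtain ⟨K, hK⟩ := exists_flow_bound hNc hN |k|
  have h1 := h.dist_le h' hφ hN (ε := 0) (hK k le_rfl) (by simp) hu hp s hs
  rw [gronwallBound_ε0_δ0] at h1
  have h2 := dist_le_zero.1 h1
  exact Prod.mk.inj h2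

/-- Global existence for the flow: the field is made bounded by clamping both coordinates at a level
that the Grönwall bound never lets the solution reach. -/
theorem exists_isFlow {φ N : ℝ → ℝ} {k b : ℝ} (hφ : LipschitzWith 1 φ) (hφ0 : φ 0 = 0)
    (hb : 0 ≤ b) (hNc : ContinuousOn N (Icc 0 b)) (hN : ∀ s ∈ Icc 0 b, 0 < N s) :
    ∃ u p : ℝ → ℝ, u 0 = 0 ∧ p 0 = 1 ∧ IsFlow φ N k b u p := by
  obtain ⟨K, hK⟩ := exists_flow_bound hNc hN |k|
  have hK := hK k le_rfl
  set A : ℝ := Real.exp (K * b) with hA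
  have hA0 : 0 < A := Real.exp_pos _
  set c : ℝ → ℝ := fun y => max (-A) (min y A) with hc
  have hcL : LipschitzWith 1 c := (LipschitzWith.id.min_const A).const_max (-A)
  have hcle : ∀ y, |c y| ≤ |y| := by
    intro y
    have := hcL.dist_le_mul y 0
    simpa [hc, Real.dist_eq, hA0.le] using this
  have hcA : ∀ y, |c y| ≤ A := by
    intro y
    rw [abs_le]
    exact ⟨le_max_left _ _, max_le (by linarith) (min_le_right _ _)⟩
  have hcid : ∀ y, |y| ≤ A → c y = y := by
    intro y hy
    rw [abs_le] at hy
    simp [hc, hy.1, hy.2]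
  have hφle : ∀ y, |φ y| ≤ |y| := by
    intro y
    have := hφ.dist_le_mul y 0
    simpa [Real.dist_eq, hφ0] using this
  set f : ℝ → ℝ × ℝ → ℝ × ℝ := fun t x => (φ (c x.2) / N t, -(k * N t * c x.1)) with hf
  have hfle : ∀ t ∈ Icc 0 b, ∀ x : ℝ × ℝ, ∀ B : ℝ, |c x.1| ≤ B → |c x.2| ≤ B →
      ‖f t x‖ ≤ K * B := by
    intro t ht x B h1 h2
    have hNt := hN t ht
    rw [Prod.norm_def]
    refine max_le ?_ ?_
    · simp only [hf, Real.norm_eq_abs, abs_div, abs_of_pos hNt]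
      rw [div_eq_mul_one_div, mul_comm]
      exact mul_le_mul (hK t ht).1 ((hφle _).trans h2) (abs_nonneg _) K.2
    · simp only [hf, Real.norm_eq_abs, abs_neg, abs_mul, abs_of_pos hNt]
      exact mul_le_mul (hK t ht).2 h1 (abs_nonneg _) K.2
  have hPL : IsPicardLindelof f (tmin := 0) (tmax := b) ⟨0, le_rfl, hb⟩ ((0, 1) : ℝ × ℝ)
      (K * ⟨A, hA0.le⟩ * ⟨b, hb⟩) 0 (K * ⟨A, hA0.le⟩) K := by
    refine ⟨fun t ht => ?_, fun x _ => ?_, fun t ht x _ => ?_, ?_⟩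
    · refine (LipschitzWith.of_dist_le_mul fun x y => ?_).lipschitzOnWith
      obtain ⟨h1, h2⟩ := hK t ht
      have hNt := hN t ht
      rw [Prod.dist_eq, Prod.dist_eq]
      have hx := le_max_left (dist x.1 y.1) (dist x.2 y.2)
      have hy := le_max_right (dist x.1 y.1) (dist x.2 y.2)
      have h3 := (hφ.comp hcL).dist_le_mul x.2 y.2
      have h4 := hcL.dist_le_mul x.1 y.1
      simp only [mul_one, NNReal.coe_one, one_mul, Function.comp_apply] at h3 h4
      refine max_le ?_ ?_
      · simp only [hf, Real.dist_eq] at hx hy h3 ⊢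
        rw [← sub_div, abs_div, abs_of_pos hNt, div_eq_mul_one_div, mul_comm]
        exact mul_le_mul h1 (h3.trans hy) (abs_nonneg _) K.2
      · simp only [hf, Real.dist_eq] at hx hy h4 ⊢
        rw [show -(k * N t * c x.1) - -(k * N t * c y.1) = -(k * N t * (c x.1 - c y.1)) by ring,
          abs_neg, abs_mul, abs_mul, abs_of_pos hNt]
        exact mul_le_mul h2 (h4.trans hx) (abs_nonneg _) K.2
    · exact (continuousOn_const.div hNc fun s hs => (hN s hs).ne').prodMk
        ((continuousOn_const.mul hNc).mul continuousOn_const).neg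
    · exact hfle t ht x A (hcA _) (hcA _)
    · have : max (b - 0) (0 - 0) = b := by simp [hb]
      change ((K * ⟨A, hA0.le⟩ : NNReal) : ℝ) * max (b - 0) (0 - 0) ≤
        ((K * ⟨A, hA0.le⟩ * ⟨b, hb⟩ : NNReal) : ℝ) - (0 : NNReal)
      rw [this, NNReal.coe_zero, sub_zero, NNReal.coe_mul _ ⟨b, hb⟩]
      rfl
  obtain ⟨α, hα0, hα⟩ := hPL.exists_eq_forall_mem_Icc_hasDerivWithinAt₀
  have hα0 : α 0 = (0, 1) := hα0
  have hbound : ∀ t ∈ Icc 0 b, ‖α t‖ ≤ A := by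
    intro t ht
    have h1 := norm_le_gronwallBound_of_norm_deriv_right_le (f := α) (f' := fun t => f t (α t))
      (δ := 1) (K := K) (ε := 0) (a := 0) (b := b)
      (fun s hs => (hα s hs).continuousWithinAt)
      (fun s hs => (hα s (Ico_subset_Icc_self hs)).mono_of_mem_nhdsWithin
        (Icc_mem_nhdsGE_of_mem hs))
      (by rw [hα0]; simp [Prod.norm_def])
      (fun s hs => by
        rw [add_zero]
        exact hfle s (Ico_subset_Icc_self hs) _ _ ((hcle _).trans (norm_fst_le (α s)))
          ((hcle _).trans (norm_snd_le (α s)))) t ht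
    rw [gronwallBound_ε0, one_mul, sub_zero] at h1
    exact h1.trans (Real.exp_le_exp.2 (mul_le_mul_of_nonneg_left ht.2 K.2))
  refine ⟨fun t => (α t).1, fun t => (α t).2, by simp [hα0], by simp [hα0], fun s hs => ?_⟩
  have h1 := hα s hs
  have h2 := hbound s hs
  have e1 := hcid (α s).1 ((norm_fst_le (α s)).trans h2)
  have e2 := hcid (α s).2 ((norm_snd_le (α s)).trans h2)
  simp only [hf, e1, e2] at h1
  exact ⟨h1.fst, h1.snd⟩

/-- The solution of `(N u')' + k N u = 0`, `u(0) = 0`, `(N u')(0) = 1` on the whole half-line. -/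
theorem exists_isFlow_forall {N : ℝ → ℝ} (k : ℝ) (hNc : ContinuousOn N (Ici 0))
    (hN : ∀ s, 0 ≤ s → 0 < N s) :
    ∃ u p : ℝ → ℝ, u 0 = 0 ∧ p 0 = 1 ∧ ∀ b, IsFlow id N k b u p := by
  have hex : ∀ n : ℕ, ∃ u p : ℝ → ℝ, u 0 = 0 ∧ p 0 = 1 ∧ IsFlow id N k n u p := fun n =>
    exists_isFlow LipschitzWith.id rfl n.cast_nonneg (hNc.mono Icc_subset_Ici_self)
      fun s hs => hN s hs.1
  choose U P hU hP hF using hex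
  have hcons : ∀ n m : ℕ, n ≤ m → ∀ s ∈ Icc (0 : ℝ) n, U n s = U m s ∧ P n s = P m s :=
    fun n m hnm => (hF n).unique ((hF m).mono (Nat.cast_le.2 hnm)) LipschitzWith.id
      (hNc.mono Icc_subset_Ici_self) (fun s hs => hN s hs.1) (by rw [hU, hU]) (by rw [hP, hP])
  refine ⟨fun s => U ⌈s⌉₊ s, fun s => P ⌈s⌉₊ s, hU _, hP _, fun b => ?_⟩
  refine ((hF ⌈b⌉₊).mono (Nat.le_ceil b)).congr (fun s hs => ?_) (fun s hs => ?_)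
  · exact (hcons _ _ (Nat.ceil_mono hs.2) s ⟨hs.1, Nat.le_ceil s⟩).1
  · exact (hcons _ _ (Nat.ceil_mono hs.2) s ⟨hs.1, Nat.le_ceil s⟩).2

/-! ### Positivity, comparison and shooting -/

theorem strictMonoOn_Icc_of_hasDerivWithinAt {g g' : ℝ → ℝ} {a b c d : ℝ}
    (hsub : Icc a b ⊆ Icc c d)
    (hd : ∀ s ∈ Icc a b, HasDerivWithinAt g (g' s) (Icc c d) s) (h0 : ∀ s ∈ Ioo a b, 0 < g' s) :
    StrictMonoOn g (Icc a b) :=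
  strictMonoOn_of_hasDerivWithinAt_pos (convex_Icc a b)
    (fun s hs => ((hd s hs).mono hsub).continuousWithinAt)
    (fun s hs => (hd s (interior_subset hs)).mono (interior_subset.trans hsub))
    (fun s hs => h0 s (by rwa [interior_Icc] at hs))

namespace IsFlow

variable {N : ℝ → ℝ} {k b : ℝ} {u p : ℝ → ℝ}

theorem fst_pos (h : IsFlow id N k b u p) (hu : u 0 = 0) (hN : ∀ s ∈ Icc 0 b, 0 < N s)
    {c : ℝ} (hc : c ≤ b) (hp : ∀ s ∈ Ico 0 c, 0 < p s) : ∀ s ∈ Ioc 0 c, 0 < u s := by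
  intro s hs
  have hsub : Icc 0 c ⊆ Icc 0 b := Icc_subset_Icc_right hc
  have := strictMonoOn_Icc_of_hasDerivWithinAt hsub (fun t ht => (h t (hsub ht)).1)
    (fun t ht => div_pos (hp t ⟨ht.1.le, ht.2⟩) (hN t (hsub (Ioo_subset_Icc_self ht))))
    ⟨le_rfl, hs.1.le.trans hs.2⟩ (Ioc_subset_Icc_self hs) hs.1
  rwa [hu] at this

/-- A solution with `u'/u ≥ 1` has no turning point. -/
theorem snd_pos (h : IsFlow id N k b u p) (hu : u 0 = 0) (hp : p 0 = 1)
    (hN : ∀ s ∈ Icc 0 b, 0 < N s) (hle : ∀ s ∈ Ioc 0 b, N s * u s ≤ p s) :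
    ∀ s ∈ Icc 0 b, 0 < p s := by
  by_contra! hcon
  obtain ⟨s₀, hs₀, hps₀⟩ := hcon
  set Z := Icc 0 b ∩ p ⁻¹' Iic 0 with hZ
  have hZc : IsClosed Z := h.continuousOn_snd.preimage_isClosed_of_isClosed isClosed_Icc isClosed_Iic
  have hZb : BddBelow Z := ⟨0, fun s hs => hs.1.1⟩
  have hmem : sInf Z ∈ Z := hZc.csInf_mem ⟨s₀, hs₀, hps₀⟩ hZb
  set c := sInf Z with hc
  have hc0 : 0 < c := by
    refine hmem.1.1.lt_of_ne fun h0 => ?_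
    have h1 : p c ≤ 0 := hmem.2
    rw [← h0, hp] at h1
    linarith
  have hpc : ∀ s ∈ Ico 0 c, 0 < p s := by
    intro s hs
    by_contra! hps
    exact absurd (csInf_le hZb (⟨⟨hs.1, hs.2.le.trans hmem.1.2⟩, hps⟩ : s ∈ Z)) (not_le.2 hs.2)
  have h1 := h.fst_pos hu hN hmem.1.2 hpc c ⟨hc0, le_rfl⟩
  have h2 := hle c ⟨hc0, hmem.1.2⟩
  have h3 : p c ≤ 0 := hmem.2
  have := mul_pos (hN c hmem.1) h1
  linarith

/-- Two solutions that vanish at `0` have the same logarithmic derivative. -/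
theorem wronskian (h : IsFlow id N k b u p) (hu : u 0 = 0) {f g : ℝ → ℝ} (h' : IsFlow id N k b f g)
    (hf : f 0 = 0) : ∀ s ∈ Icc 0 b, u s * g s = f s * p s := by
  intro s hs
  have hd : ∀ t ∈ Icc 0 b,
      HasDerivWithinAt (fun t => u t * g t - f t * p t) 0 (Icc 0 b) t := by
    intro t ht
    have := ((h t ht).1.mul (h' t ht).2).sub ((h' t ht).1.mul (h t ht).2)
    refine this.congr_deriv ?_
    simp only [id]
    ring
  have hmono := monotoneOn_Icc_of_hasDerivWithinAt Subset.rfl hd fun _ _ => le_rfl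
  have hanti := monotoneOn_Icc_of_hasDerivWithinAt Subset.rfl (fun t ht => (hd t ht).neg)
    (fun _ _ => by simp)
  have h0 : (0 : ℝ) ∈ Icc 0 b := ⟨le_rfl, hs.1.trans hs.2⟩
  have h1 := hmono h0 hs hs.1
  have h2 := hanti h0 hs hs.1
  simp only [hu, hf, Pi.neg_apply] at h1 h2
  linarith

/-- A solution that vanishes at `0` is a multiple of a solution that is positive on `]0, b]`. -/
theorem ratio_eq (h : IsFlow id N k b u p) (hu : u 0 = 0) (hupos : ∀ s ∈ Ioc 0 b, 0 < u s)
    {f g : ℝ → ℝ} (h' : IsFlow id N k b f g) (hf : f 0 = 0) :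
    ∀ s ∈ Ioc 0 b, ∀ t ∈ Ioc 0 b, f s / u s = f t / u t := by
  have hmain : ∀ s ∈ Ioc 0 b, f s / u s = f b / u b := by
    intro s hs
    have hsub : Icc s b ⊆ Icc 0 b := Icc_subset_Icc_left hs.1.le
    have hd : ∀ t ∈ Icc s b, HasDerivWithinAt (fun t => f t / u t) 0 (Icc 0 b) t := by
      intro t ht
      have hut := (hupos t ⟨hs.1.trans_le ht.1, ht.2⟩).ne'
      refine ((h' t (hsub ht)).1.div (h t (hsub ht)).1 hut).congr_deriv ?_
      have hw := h.wronskian hu h' hf t (hsub ht)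
      have h1 : g t / N t * u t - f t * (p t / N t) = 0 := by
        rw [mul_comm] at hw
        rw [div_mul_eq_mul_div, hw]; ring
      simp only [id]
      rw [h1, zero_div]
    have hmono := monotoneOn_Icc_of_hasDerivWithinAt hsub hd fun _ _ => le_rfl
    have hanti := monotoneOn_Icc_of_hasDerivWithinAt hsub (fun t ht => (hd t ht).neg)
      (fun _ _ => by simp)
    have h1 := hmono ⟨le_rfl, hs.2⟩ ⟨hs.2, le_rfl⟩ hs.2
    have h2 := hanti ⟨le_rfl, hs.2⟩ ⟨hs.2, le_rfl⟩ hs.2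
    simp only [Pi.neg_apply] at h1 h2
    linarith
  intro s hs t ht
  rw [hmain s hs, hmain t ht]

/-- Picone's identity: a Dirichlet–Robin problem with a positive solution for the parameter `k` has
no solution for a smaller parameter. -/
theorem le_of_robin (h : IsFlow id N k b u p) (hu : u 0 = 0) (hp : p 0 = 1)
    (hppos : ∀ s ∈ Icc 0 b, 0 < p s) (hN : ∀ s ∈ Icc 0 b, 0 < N s)
    (hrobin : p b = N b * u b) (hb : 0 < b) {k' : ℝ} {f g : ℝ → ℝ}
    (h' : IsFlow id N k' b f g) (hf : f 0 = 0) (hfb : g b = N b * f b)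
    (hne : ∃ s ∈ Icc 0 b, f s ≠ 0) : k ≤ k' := by
  by_contra! hk
  have hupos := h.fst_pos hu hN le_rfl fun s hs => hppos s (Ico_subset_Icc_self hs)
  have h0b : (0 : ℝ) ∈ Icc 0 b := ⟨le_rfl, hb.le⟩
  set Q : ℝ → ℝ := fun s => f s * g s - f s ^ 2 * p s / u s with hQ
  have hdQ : ∀ s ∈ Ioc 0 b, HasDerivWithinAt Q
      ((g s - f s * p s / u s) ^ 2 / N s + (k - k') * N s * f s ^ 2) (Icc 0 b) s := by
    intro s hs
    have hs' := Ioc_subset_Icc_self hs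
    have hus := (hupos s hs).ne'
    have hNs := (hN s hs').ne'
    have h1 := ((h' s hs').1.mul (h' s hs').2).sub
      ((((h' s hs').1.pow 2).mul (h s hs').2).div (h s hs').1 hus)
    refine h1.congr_deriv ?_
    simp only [id, Pi.mul_apply, Pi.pow_apply]
    field_simp
    push_cast
    ring
  have hQnn : ∀ s ∈ Ioc 0 b, 0 ≤ (g s - f s * p s / u s) ^ 2 / N s + (k - k') * N s * f s ^ 2 := by
    intro s hs
    have hNs := hN s (Ioc_subset_Icc_self hs)
    have : 0 ≤ k - k' := by linarith
    positivity
  have hmono : MonotoneOn Q (Ioc 0 b) := by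
    intro s hs t ht hst
    have hsub : Icc s t ⊆ Icc 0 b := Icc_subset_Icc hs.1.le ht.2
    exact monotoneOn_Icc_of_hasDerivWithinAt hsub
      (fun τ hτ => hdQ τ ⟨hs.1.trans_le hτ.1, hτ.2.trans ht.2⟩)
      (fun τ hτ => hQnn τ ⟨hs.1.trans_le hτ.1, hτ.2.trans ht.2⟩) ⟨le_rfl, hst⟩ ⟨hst, le_rfl⟩ hst
  have hQb : Q b = 0 := by
    have := (hupos b ⟨hb, le_rfl⟩).ne'
    simp only [hQ, hrobin, hfb]
    field_simp
    ring
  -- the boundary term at `0` vanishes, because `f` and `u` are both of order `s`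
  have hQ0 : Tendsto Q (𝓝[>] 0) (𝓝 0) := by
    have hnhds : 𝓝[>] (0 : ℝ) ≤ 𝓝[Icc 0 b] 0 :=
      nhdsWithin_le_iff.2 (mem_of_superset (Ioc_mem_nhdsGT hb) Ioc_subset_Icc_self)
    have hslope : ∀ y : ℝ → ℝ, y 0 = 0 → ∀ y', HasDerivWithinAt y y' (Icc 0 b) 0 →
        Tendsto (fun s => y s / s) (𝓝[>] 0) (𝓝 y') := by
      intro y hy y' hy'
      have h1 := (hasDerivWithinAt_iff_tendsto_slope' (by simp)).1
        (hy'.mono_of_mem_nhdsWithin (hnhds self_mem_nhdsWithin) : HasDerivWithinAt y y' (Ioi 0) 0)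
      refine h1.congr fun s => ?_
      simp [slope_def_field, hy]
    have hf' := hslope f hf _ (h' 0 h0b).1
    have hu' := hslope u hu _ (h 0 h0b).1
    have hfc : Tendsto f (𝓝[>] 0) (𝓝 0) := by
      have := (h'.continuousOn_fst 0 h0b).mono_left hnhds
      rwa [hf] at this
    have hgc := (h'.continuousOn_snd 0 h0b).mono_left hnhds
    have hpc := (h.continuousOn_snd 0 h0b).mono_left hnhds
    have hune : id (p 0) / N 0 ≠ 0 := by
      rw [hp]
      exact div_ne_zero one_ne_zero (hN 0 h0b).ne'
    have hlim := (hfc.mul hgc).sub ((hfc.mul ((hf'.div hu' hune).mul hpc)))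
    simp only [zero_mul, sub_zero] at hlim
    refine hlim.congr' ?_
    filter_upwards [Ioc_mem_nhdsGT hb] with s hs
    have h1 := (hupos s hs).ne'
    have h2 := hs.1.ne'
    simp only [hQ, Pi.div_apply]
    field_simp
  have hQge : ∀ s ∈ Ioc 0 b, 0 ≤ Q s := by
    intro s hs
    refine le_of_tendsto hQ0 ?_
    filter_upwards [Ioc_mem_nhdsGT hs.1] with t ht
    exact hmono ⟨ht.1, ht.2.trans hs.2⟩ hs ht.2
  have hQz : ∀ s ∈ Ioc 0 b, Q s = 0 := fun s hs =>
    le_antisymm ((hmono hs ⟨hb, le_rfl⟩ hs.2).trans_eq hQb) (hQge s hs)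
  have hfz : ∀ s ∈ Ioo 0 b, f s = 0 := by
    intro s hs
    have h1 := (hdQ s (Ioo_subset_Ioc_self hs)).hasDerivAt (Icc_mem_nhds hs.1 hs.2)
    have h2 : HasDerivAt Q 0 s := by
      refine (hasDerivAt_const s (0 : ℝ)).congr_of_eventuallyEq ?_
      filter_upwards [Ioo_mem_nhds hs.1 hs.2] with t ht
      exact hQz t (Ioo_subset_Ioc_self ht)
    have h3 := h1.unique h2
    have hNs := hN s (Ioo_subset_Icc_self hs)
    have h4 : 0 ≤ (g s - f s * p s / u s) ^ 2 / N s := by positivity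
    have h5 : 0 < (k - k') * N s := mul_pos (by linarith) hNs
    have h6 : f s ^ 2 ≤ 0 := by
      by_contra! h7
      have := mul_pos h5 h7
      linarith
    exact pow_eq_zero_iff (n := 2) two_ne_zero |>.1 (le_antisymm h6 (sq_nonneg _))
  obtain ⟨s, hs, hfs⟩ := hne
  have hcl : Icc 0 b ⊆ closure (Ioo 0 b) := by rw [closure_Ioo hb.ne]
  have := h'.continuousOn_fst.mono (s := Icc 0 b) Subset.rfl
  have heq : EqOn f (fun _ => 0) (Icc 0 b) :=
    EqOn.of_subset_closure hfz h'.continuousOn_fst continuousOn_const Ioo_subset_Icc_self hcl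
  exact hfs (heq hs)

end IsFlow

/-- The shooting method: if the solution for `k = 1` satisfies `u' > u` at `b`, the Dirichlet–Robin
condition `u'(b) = u(b)` holds for some larger parameter, with a solution without turning point. -/
theorem exists_robin_parameter {N : ℝ → ℝ} {b : ℝ} (hb : 0 < b) (hNc : ContinuousOn N (Icc 0 b))
    (hN : ∀ s ∈ Icc 0 b, 0 < N s) {u p : ℝ → ℝ} (h : IsFlow id N 1 b u p) (hu : u 0 = 0)
    (hp : p 0 = 1) (hppos : ∀ s ∈ Icc 0 b, 0 < p s) (hgt : N b * u b < p b) :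
    ∃ k, 1 < k ∧ ∃ f g : ℝ → ℝ, IsFlow id N k b f g ∧ f 0 = 0 ∧ g 0 = 1 ∧
      (∀ s ∈ Icc 0 b, 0 < g s) ∧ g b = N b * f b := by
  have hbb : b ∈ Icc 0 b := ⟨hb.le, le_rfl⟩
  have h0b : (0 : ℝ) ∈ Icc 0 b := ⟨le_rfl, hb.le⟩
  have hφ : LipschitzWith 1 fun y : ℝ => max y 0 := LipschitzWith.id.max_const 0
  choose U P hU hP hF using fun k : ℝ =>
    exists_isFlow (φ := fun y => max y 0) (k := k) hφ (by simp) hb.le hNc hN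
  have hUmono : ∀ k, MonotoneOn (U k) (Icc 0 b) := fun k =>
    monotoneOn_Icc_of_hasDerivWithinAt Subset.rfl (fun s hs => (hF k s hs).1)
      fun s hs => div_nonneg (le_max_right _ _) (hN s hs).le
  have hUnn : ∀ k, ∀ s ∈ Icc 0 b, 0 ≤ U k s := fun k s hs => by
    rw [← hU k]; exact hUmono k h0b hs hs.1
  have hPanti : ∀ k, 0 ≤ k → ∀ s ∈ Icc 0 b, ∀ t ∈ Icc 0 b, s ≤ t → P k t ≤ P k s := by
    intro k hk s hs t ht hst
    have := monotoneOn_Icc_of_hasDerivWithinAt Subset.rfl (fun s hs => (hF k s hs).2.neg)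
      (fun s hs => by
        rw [neg_neg]
        exact mul_nonneg (mul_nonneg hk (hN s hs).le) (hUnn k s hs)) hs ht hst
    simpa using this
  -- as long as `P` is positive, the truncation is not felt
  have hFid : ∀ k, (∀ s ∈ Icc 0 b, 0 < P k s) → IsFlow id N k b (U k) (P k) := by
    intro k hk s hs
    have := hF k s hs
    simp only [max_eq_left (hk s hs).le] at this
    exact this
  set D : ℝ → ℝ := fun k => P k b - N b * U k b with hD
  have hD1 : 0 < D 1 := by
    have h1 : IsFlow (fun y => max y 0) N 1 b u p := by
      intro s hs
      have := h s hs
      rwa [show id (p s) = max (p s) 0 from (max_eq_left (hppos s hs).le).symm] at this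
    obtain ⟨e1, e2⟩ := (hF 1).unique h1 hφ hNc hN (by rw [hU, hu]) (by rw [hP, hp]) b hbb
    simp only [hD, e1, e2]
    linarith
  obtain ⟨c₁, hc₁, hc₁N⟩ : ∃ c, 0 < c ∧ ∀ s ∈ Icc 0 b, c ≤ N s := by
    obtain ⟨s, hs, hmin⟩ := isCompact_Icc.exists_isMinOn ⟨0, h0b⟩ hNc
    exact ⟨N s, hN s hs, fun t ht => hmin ht⟩
  obtain ⟨c₂, hc₂, hc₂N⟩ : ∃ c, 0 < c ∧ ∀ s ∈ Icc 0 b, N s ≤ c := by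
    obtain ⟨s, hs, hmax⟩ := isCompact_Icc.exists_isMaxOn ⟨0, h0b⟩ hNc
    exact ⟨N s, hN s hs, fun t ht => hmax ht⟩
  -- for a large parameter, `P` drops to zero between `b / 2` and `b`
  set k₁ : ℝ := max 1 (4 * c₂ / (c₁ * b ^ 2)) with hk₁
  have hk₁1 : 1 ≤ k₁ := le_max_left _ _
  have hDk : D k₁ ≤ 0 := by
    by_contra! hcon
    have hUb := hUnn k₁ b hbb
    have hPb : 0 < P k₁ b := by
      have := mul_nonneg (hN b hbb).le hUb
      simp only [hD] at hcon
      linarith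
    have hPpos : ∀ s ∈ Icc 0 b, 0 < P k₁ s := fun s hs =>
      hPb.trans_le (hPanti k₁ (by linarith) s hs b hbb hs.2)
    set c := b / 2 with hc
    have hcm : c ∈ Icc 0 b := ⟨by positivity, by linarith⟩
    have hsub1 : Icc 0 c ⊆ Icc 0 b := Icc_subset_Icc_right hcm.2
    have hsub2 : Icc c b ⊆ Icc 0 b := Icc_subset_Icc_left hcm.1
    have h1 : P k₁ c / c₂ * c ≤ U k₁ c := by
      have := monotoneOn_Icc_of_hasDerivWithinAt hsub1
        (fun s hs => (hF k₁ s (hsub1 hs)).1.sub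
          ((hasDerivWithinAt_id s (Icc 0 b)).const_mul (P k₁ c / c₂)))
        (fun s hs => by
          have h2 := hPanti k₁ (by linarith) s (hsub1 hs) c hcm hs.2
          have h3 := hc₂N s (hsub1 hs)
          have h4 := hN s (hsub1 hs)
          have h5 := hPpos c hcm
          rw [mul_one, sub_nonneg]
          calc P k₁ c / c₂ ≤ P k₁ s / N s := by gcongr; linarith
            _ ≤ _ := by gcongr; exact le_max_left _ _) ⟨le_rfl, hcm.1⟩ ⟨hcm.1, le_rfl⟩ hcm.1
      simp only [Pi.sub_apply, id, hU, mul_zero, sub_zero] at this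
      linarith
    have h2 : P k₁ b + k₁ * c₁ * U k₁ c * (b - c) ≤ P k₁ c := by
      have := monotoneOn_Icc_of_hasDerivWithinAt hsub2
        (fun s hs => (hF k₁ s (hsub2 hs)).2.neg.sub
          ((hasDerivWithinAt_id s (Icc 0 b)).const_mul (k₁ * c₁ * U k₁ c)))
        (fun s hs => by
          have h3 := hUmono k₁ hcm (hsub2 hs) hs.1
          have h4 := hc₁N s (hsub2 hs)
          have h5 := hUnn k₁ c hcm
          have h6 := hN s (hsub2 hs)
          rw [mul_one, neg_neg, sub_nonneg]
          gcongr) ⟨le_rfl, hcm.2⟩ ⟨hcm.2, le_rfl⟩ hcm.2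
      simp only [Pi.sub_apply, id, Pi.neg_apply] at this
      linarith
    have h3 : 4 * c₂ / (c₁ * b ^ 2) ≤ k₁ := le_max_right _ _
    rw [div_le_iff₀ (by positivity)] at h3
    have h5 := hPpos c hcm
    have h6 : P k₁ c ≤ k₁ * c₁ * U k₁ c * (b - c) := by
      calc P k₁ c = P k₁ c * (4 * c₂) / (4 * c₂) := by field_simp
        _ ≤ P k₁ c * (k₁ * (c₁ * b ^ 2)) / (4 * c₂) := by gcongr
        _ = k₁ * c₁ * (P k₁ c / c₂ * c) * (b - c) := by rw [hc]; field_simp; ring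
        _ ≤ _ := by
          have : 0 ≤ b - c := by linarith [hcm.2]
          gcongr
    linarith
  have hDcont : ContinuousOn D (Icc 1 k₁) := by
    intro k₀ hk₀
    obtain ⟨K, hK⟩ := exists_flow_bound hNc hN k₁
    obtain ⟨C, hC⟩ := isCompact_Icc.bddAbove_image
      (hNc.mul ((hF k₀).continuousOn_fst.abs) : ContinuousOn (fun s => N s * |U k₀ s|) (Icc 0 b))
    have hdist : ∀ k ∈ Icc 1 k₁, dist (D k) (D k₀) ≤
        (1 + N b) * gronwallBound 0 K (|k - k₀| * C) b := by
      intro k hk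
      have hk0 : |k| ≤ k₁ := by rw [abs_of_nonneg (by linarith [hk.1])]; exact hk.2
      have h1 := (hF k).dist_le (hF k₀) hφ hN (hK k hk0) (ε := |k - k₀| * C) (fun s hs => by
        rw [mul_assoc]
        exact mul_le_mul_of_nonneg_left (hC (mem_image_of_mem _ hs)) (abs_nonneg _))
        (by rw [hU, hU]) (by rw [hP, hP]) b hbb
      rw [Prod.dist_eq, max_le_iff] at h1
      obtain ⟨h2, h3⟩ := h1
      simp only [Real.dist_eq] at h2 h3 ⊢
      have hNb := hN b hbb
      calc |D k - D k₀| = |(P k b - P k₀ b) - N b * (U k b - U k₀ b)| := by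
            simp only [hD]; congr 1; ring
        _ ≤ |P k b - P k₀ b| + N b * |U k b - U k₀ b| := by
            refine (abs_sub _ _).trans_eq ?_
            rw [abs_mul, abs_of_pos hNb]
        _ ≤ gronwallBound 0 K (|k - k₀| * C) b + N b * gronwallBound 0 K (|k - k₀| * C) b := by
            gcongr
        _ = _ := by ring
    refine tendsto_iff_dist_tendsto_zero.2 ?_
    refine squeeze_zero' (Eventually.of_forall fun _ => dist_nonneg)
      (eventually_nhdsWithin_of_forall hdist) ?_
    have hcont : Continuous fun k => (1 + N b) * gronwallBound 0 K (|k - k₀| * C) b :=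
      continuous_const.mul ((gronwallBound_continuous_ε 0 K b).comp (by fun_prop))
    refine (hcont.tendsto' k₀ 0 ?_).mono_left nhdsWithin_le_nhds
    simp [gronwallBound_ε0_δ0]
  obtain ⟨k, hk, hDk0⟩ := intermediate_value_Icc' hk₁1 hDcont ⟨hDk, hD1.le⟩
  have hk1 : 1 < k := hk.1.lt_of_ne fun h1 => by rw [← h1] at hDk0; linarith
  have hrob : P k b = N b * U k b := by simp only [hD] at hDk0; linarith
  have hUb : 0 < U k b := by
    refine (hUnn k b hbb).lt_of_ne fun h0 => ?_
    have hUz : ∀ s ∈ Icc 0 b, U k s = 0 := fun s hs =>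
      le_antisymm ((hUmono k hs hbb hs.2).trans_eq h0.symm) (hUnn k s hs)
    have := monotoneOn_Icc_of_hasDerivWithinAt Subset.rfl (fun s hs => (hF k s hs).2)
      (fun s hs => by rw [hUz s hs]; simp) h0b hbb hb.le
    rw [hP, hrob, ← h0] at this
    simp at this
    linarith
  have hPpos : ∀ s ∈ Icc 0 b, 0 < P k s := fun s hs =>
    (hrob ▸ mul_pos (hN b hbb) hUb : 0 < P k b).trans_le
      (hPanti k (by linarith) s hs b hbb hs.2)
  exact ⟨k, hk1, U k, P k, hFid k hPpos, hU k, hP k, hPpos, hrob⟩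

/-! ### Weak solutions, the lowest eigenvalue and `a*` -/

theorem hasDerivWithinAt_Icc_of_eq_integral {y g : ℝ → ℝ} {b : ℝ}
    (hg : ContinuousOn g (Icc 0 b)) (hy : ∀ s ∈ Icc 0 b, y s = y 0 + ∫ t in (0 : ℝ)..s, g t) :
    ∀ s ∈ Icc 0 b, HasDerivWithinAt y (g s) (Icc 0 b) s := by
  intro s hs
  have hb : 0 ≤ b := hs.1.trans hs.2
  set G : ℝ → ℝ := IccExtend hb ((Icc 0 b).domRestrict g) with hG
  have hGc : Continuous G := (continuousOn_iff_continuous_domRestrict.1 hg).Icc_extend'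
  have hGg : ∀ t ∈ Icc 0 b, G t = g t := fun t ht => by
    rw [hG, IccExtend_of_mem hb _ ht]; rfl
  have hyG : ∀ t ∈ Icc 0 b, y t = y 0 + ∫ τ in (0 : ℝ)..t, G τ := by
    intro t ht
    rw [hy t ht]
    congr 1
    refine intervalIntegral.integral_congr fun τ hτ => ?_
    rw [uIcc_of_le ht.1] at hτ
    exact (hGg τ ⟨hτ.1, hτ.2.trans ht.2⟩).symm
  have h1 := ((hGc.integral_hasStrictDerivAt 0 s).hasDerivAt.const_add (y 0)).hasDerivWithinAt
    (s := Icc 0 b)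
  rw [hGg s hs] at h1
  exact h1.congr hyG (hyG s hs)

theorem eq_integral_of_hasDerivWithinAt_Icc {y g : ℝ → ℝ} {b : ℝ}
    (hg : ContinuousOn g (Icc 0 b))
    (hy : ∀ s ∈ Icc 0 b, HasDerivWithinAt y (g s) (Icc 0 b) s) :
    ∀ s ∈ Icc 0 b, y s = y 0 + ∫ t in (0 : ℝ)..s, g t := by
  intro s hs
  have hsub : Icc 0 s ⊆ Icc 0 b := Icc_subset_Icc_right hs.2
  rw [intervalIntegral.integral_eq_sub_of_hasDeriv_right_of_le hs.1
    (fun t ht => ((hy t (hsub ht)).mono hsub).continuousWithinAt)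
    (fun t ht => (hy t (hsub (Ioo_subset_Icc_self ht))).mono_of_mem_nhdsWithin
      (mem_of_superset (Ioc_mem_nhdsGT (ht.2.trans_le hs.2))
        fun τ hτ => ⟨ht.1.le.trans hτ.1.le, hτ.2⟩))
    ((hg.mono hsub).intervalIntegrable_of_Icc hs.1)]
  ring

section Weight

variable {μ : ℝ → ℝ}

theorem hasDerivWithinAt_weight (hμ : ContDiffOn ℝ 1 μ (Ici 0)) {s : ℝ} (hs : 0 ≤ s) (b : ℝ) :
    HasDerivWithinAt μ (derivWithin μ (Ici 0) s) (Icc 0 b) s :=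
  (hμ.differentiableOn one_ne_zero s hs).hasDerivWithinAt.mono Icc_subset_Ici_self

theorem continuousOn_derivWithin_weight (hμ : ContDiffOn ℝ 1 μ (Ici 0)) (b : ℝ) :
    ContinuousOn (derivWithin μ (Ici 0)) (Icc 0 b) :=
  (hμ.continuousOn_derivWithin (uniqueDiffOn_Ici 0) le_rfl).mono Icc_subset_Ici_self

theorem deriv_weight {s : ℝ} (hs : 0 < s) : deriv μ s = derivWithin μ (Ici 0) s :=
  (derivWithin_of_mem_nhds (Ici_mem_nhds hs)).symm

theorem opK_eq_iff {r l : ℝ} (hr : 0 < r) {u v w : ℝ → ℝ} {s : ℝ} (hμs : 0 < μ s) :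
    opK r μ u v w s = l * u s ↔
      w s = -(2 * deriv μ s / μ s * v s) - r ^ 2 * (1 + l) * u s := by
  have h1 : opK r μ u v w s - l * u s =
      -(1 / r ^ 2) * (w s - (-(2 * deriv μ s / μ s * v s) - r ^ 2 * (1 + l) * u s)) := by
    unfold opK
    field_simp
    ring
  rw [← sub_eq_zero, h1, mul_eq_zero, sub_eq_zero]
  have : -(1 / r ^ 2) ≠ 0 := by
    rw [neg_ne_zero]; positivity
  simp only [this, false_or]

/-- A weak solution in `H²` is a classical solution: the continuous right-hand side of the equation
is a representative of the second derivative. -/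
theorem isFlow_of_isSobolevTwo (hμ : ContDiffOn ℝ 1 μ (Ici 0)) (hμ0 : ∀ s, 0 ≤ s → 0 < μ s)
    {r l b : ℝ} (hr : 0 < r) (hb : 0 < b) {u v w : ℝ → ℝ} (h : IsSobolevTwo b u v w)
    (hK : ∀ᵐ s ∂(volume.restrict (Ioo 0 b)), opK r μ u v w s = l * u s) :
    IsFlow id (fun s => μ s ^ 2) (r ^ 2 * (1 + l)) b u (fun s => μ s ^ 2 * v s) := by
  have hwi : IntervalIntegrable w volume 0 b := by
    rw [intervalIntegrable_iff_integrableOn_Ioo_of_le hb.le]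
    exact h.memLp.integrable (by norm_num)
  have hvc : ContinuousOn v (Icc 0 b) := by
    have := intervalIntegral.continuousOn_primitive_interval' hwi (left_mem_uIcc)
    rw [uIcc_of_le hb.le] at this
    exact (continuousOn_const.add this).congr h.snd_deriv
  have hud := hasDerivWithinAt_Icc_of_eq_integral hvc h.fst_deriv
  have huc : ContinuousOn u (Icc 0 b) := fun s hs => (hud s hs).continuousWithinAt
  have hμc : ContinuousOn μ (Icc 0 b) := hμ.continuousOn.mono Icc_subset_Ici_self
  set g : ℝ → ℝ := fun s =>
    -(2 * derivWithin μ (Ici 0) s / μ s * v s) - r ^ 2 * (1 + l) * u s with hg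
  have hgc : ContinuousOn g (Icc 0 b) :=
    ((((continuousOn_const.mul (continuousOn_derivWithin_weight hμ b)).div hμc
      fun s hs => (hμ0 s hs.1).ne').mul hvc).neg).sub (continuousOn_const.mul huc)
  have hwg : ∀ᵐ s ∂volume, s ∈ Ioo 0 b → w s = g s := by
    rw [← ae_restrict_iff' measurableSet_Ioo]
    filter_upwards [hK, ae_restrict_mem measurableSet_Ioo] with s hs hs'
    rw [(opK_eq_iff hr (hμ0 s hs'.1.le)).1 hs, deriv_weight hs'.1]
  have hvd := hasDerivWithinAt_Icc_of_eq_integral (y := v) hgc fun s hs => by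
    rw [h.snd_deriv s hs]
    congr 1
    refine intervalIntegral.integral_congr_ae ?_
    have hne : ∀ᵐ t : ℝ ∂volume, t ≠ s := by simp [ae_iff]
    filter_upwards [hwg, hne] with t ht hts ht'
    rw [uIoc_of_le hs.1] at ht'
    exact ht ⟨ht'.1, (ht'.2.lt_of_ne hts).trans_le hs.2⟩
  intro s hs
  have hμs := (hμ0 s hs.1).ne'
  constructor
  · refine (hud s hs).congr_deriv ?_
    simp only [id]
    field_simp
  · refine (((hasDerivWithinAt_weight hμ hs.1 b).pow 2).mul (hvd s hs)).congr_deriv ?_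
    simp only [hg, Pi.pow_apply]
    field_simp
    push_cast
    ring

/-- The converse of `isFlow_of_isSobolevTwo`; `μ` is `C¹`, so that the derivative `v` of a classical
solution is `C¹` as well. -/
theorem isSobolevTwo_of_isFlow (hμ : ContDiffOn ℝ 1 μ (Ici 0)) (hμ0 : ∀ s, 0 ≤ s → 0 < μ s)
    {r l b : ℝ} (hr : 0 < r) {u v : ℝ → ℝ}
    (h : IsFlow id (fun s => μ s ^ 2) (r ^ 2 * (1 + l)) b u (fun s => μ s ^ 2 * v s)) :
    ∃ w, IsSobolevTwo b u v w ∧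
      ∀ᵐ s ∂(volume.restrict (Ioo 0 b)), opK r μ u v w s = l * u s := by
  have hμc : ContinuousOn μ (Icc 0 b) := hμ.continuousOn.mono Icc_subset_Ici_self
  have hne : ∀ s ∈ Icc 0 b, μ s ^ 2 ≠ 0 := fun s hs => (pow_pos (hμ0 s hs.1) 2).ne'
  set g : ℝ → ℝ := fun s =>
    -(2 * derivWithin μ (Ici 0) s / μ s * v s) - r ^ 2 * (1 + l) * u s with hg
  have hvd : ∀ s ∈ Icc 0 b, HasDerivWithinAt v (g s) (Icc 0 b) s := by
    intro s hs
    have hμs := (hμ0 s hs.1).ne'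
    have h1 := (h s hs).2.div ((hasDerivWithinAt_weight hμ hs.1 b).pow 2) (hne s hs)
    refine (h1.congr_deriv ?_).congr (fun t ht => ?_) ?_
    · simp only [hg, Pi.pow_apply]
      field_simp
      push_cast
      ring
    · have := (hμ0 t ht.1).ne'
      simp only [Pi.div_apply, Pi.pow_apply]
      field_simp
    · simp only [Pi.div_apply, Pi.pow_apply]
      field_simp
  have hud : ∀ s ∈ Icc 0 b, HasDerivWithinAt u (v s) (Icc 0 b) s := by
    intro s hs
    refine (h s hs).1.congr_deriv ?_
    have := (hμ0 s hs.1).ne'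
    simp only [id]
    field_simp
  have hvc : ContinuousOn v (Icc 0 b) := fun s hs => (hvd s hs).continuousWithinAt
  have huc : ContinuousOn u (Icc 0 b) := fun s hs => (hud s hs).continuousWithinAt
  have hgc : ContinuousOn g (Icc 0 b) :=
    ((((continuousOn_const.mul (continuousOn_derivWithin_weight hμ b)).div hμc
      fun s hs => (hμ0 s hs.1).ne').mul hvc).neg).sub (continuousOn_const.mul huc)
  refine ⟨g, ⟨?_, eq_integral_of_hasDerivWithinAt_Icc hvc hud,
    eq_integral_of_hasDerivWithinAt_Icc hgc hvd⟩, ?_⟩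
  · obtain ⟨C, hC⟩ := isCompact_Icc.exists_bound_of_continuousOn hgc
    refine MemLp.of_bound ((hgc.mono Ioo_subset_Icc_self).aestronglyMeasurable measurableSet_Ioo)
      C ?_
    filter_upwards [ae_restrict_mem measurableSet_Ioo] with s hs
    exact hC s (Ioo_subset_Icc_self hs)
  · filter_upwards [ae_restrict_mem measurableSet_Ioo] with s hs
    rw [opK_eq_iff hr (hμ0 s hs.1.le), deriv_weight hs.1]

theorem isDREigenfunction_iff (hμ : ContDiffOn ℝ 1 μ (Ici 0)) (hμ0 : ∀ s, 0 ≤ s → 0 < μ s)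
    {l b : ℝ} (hb : 0 < b) {u v : ℝ → ℝ} :
    IsDREigenfunction μ b l u v ↔
      IsFlow id (fun s => μ s ^ 2) (1 + l) b u (fun s => μ s ^ 2 * v s) ∧ u 0 = 0 ∧ v b = u b ∧
        ∃ s ∈ Icc 0 b, u s ≠ 0 := by
  constructor
  · rintro ⟨w, hS, hu, hv, hne, hK⟩
    have := isFlow_of_isSobolevTwo hμ hμ0 one_pos hb hS hK
    rw [one_pow, one_mul] at this
    exact ⟨this, hu, hv, hne⟩
  · rintro ⟨h, hu, hv, hne⟩
    obtain ⟨w, hS, hK⟩ := isSobolevTwo_of_isFlow (r := 1) (l := l) hμ hμ0 one_pos (by simpa using h)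
    exact ⟨w, hS, hu, hv, hne, hK⟩

theorem isHarmonicFromZero_iff (hμ : ContDiffOn ℝ 1 μ (Ici 0)) (hμ0 : ∀ s, 0 ≤ s → 0 < μ s)
    {r : ℝ} (hr : 0 < r) {u v : ℝ → ℝ} :
    IsHarmonicFromZero r μ u v ↔
      (∀ b, 0 < b → IsFlow id (fun s => μ s ^ 2) (r ^ 2) b u (fun s => μ s ^ 2 * v s)) ∧
        u 0 = 0 ∧ ∃ s, 0 < s ∧ u s ≠ 0 := by
  refine and_congr_left fun _ => forall_congr' fun b => forall_congr' fun hb => ⟨?_, fun h => ?_⟩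
  · rintro ⟨w, hS, hK⟩
    have := isFlow_of_isSobolevTwo (l := 0) hμ hμ0 hr hb hS (by simpa using hK)
    simpa using this
  · obtain ⟨w, hS, hK⟩ := isSobolevTwo_of_isFlow (r := r) (l := 0) (b := b) hμ hμ0 hr
      (by simpa using h)
    exact ⟨w, hS, by simpa using hK⟩

/-- An eigenvalue of the Dirichlet–Robin problem with an increasing eigenfunction is the lowest one. In
particular the infimum in `lambdaDR` is attained. -/
theorem lambdaDR_eq (hμ : ContDiffOn ℝ 1 μ (Ici 0)) (hμ0 : ∀ s, 0 ≤ s → 0 < μ s)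
    {k b : ℝ} (hb : 0 < b) {f g : ℝ → ℝ} (h : IsFlow id (fun s => μ s ^ 2) k b f g)
    (hf : f 0 = 0) (hg : g 0 = 1) (hpos : ∀ s ∈ Icc 0 b, 0 < g s) (hrob : g b = μ b ^ 2 * f b) :
    lambdaDR μ b = k - 1 := by
  have hN : ∀ s ∈ Icc 0 b, 0 < μ s ^ 2 := fun s hs => pow_pos (hμ0 s hs.1) 2
  have hfpos := h.fst_pos hf hN le_rfl fun s hs => hpos s (Ico_subset_Icc_self hs)
  have hbb : b ∈ Icc 0 b := ⟨hb.le, le_rfl⟩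
  refine IsLeast.csInf_eq ⟨⟨f, fun s => g s / μ s ^ 2, ?_⟩, ?_⟩
  · rw [isDREigenfunction_iff hμ hμ0 hb]
    refine ⟨?_, hf, ?_, b, hbb, (hfpos b ⟨hb, le_rfl⟩).ne'⟩
    · rw [add_sub_cancel]
      refine h.congr (fun _ _ => rfl) fun s hs => ?_
      have := (hμ0 s hs.1).ne'
      field_simp
    · have := (hμ0 b hb.le).ne'
      simp only [hrob]
      field_simp
  · rintro l ⟨u, v, huv⟩
    rw [isDREigenfunction_iff hμ hμ0 hb] at huv
    obtain ⟨h', hu, hv, hne⟩ := huv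
    have := h.le_of_robin hf hg hpos hN hrob hb h' hu (by rw [hv]) hne
    linarith

/-- `A` is the first point at which the Robin condition `p = N u`, that is `u' = u`, holds, or
`+∞` if there is none. -/
structure IsFirstRobinPoint (N u p : ℝ → ℝ) (A : EReal) : Prop where
  pos : 0 < A
  lt : ∀ s : ℝ, 0 < s → (s : EReal) < A → N s * u s < p s
  eq : ∀ c : ℝ, A = c → p c = N c * u c

theorem exists_isFirstRobinPoint {N u p : ℝ → ℝ} (hN : ContinuousOn N (Ici 0))
    (hu : u 0 = 0) (hp : p 0 = 1) (h : ∀ b, IsFlow id N 1 b u p) :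
    ∃ A, IsFirstRobinPoint N u p A := by
  set Z : Set ℝ := {s | 0 ≤ s ∧ p s ≤ N s * u s} with hZ
  have hZb : BddBelow Z := ⟨0, fun s hs => hs.1⟩
  have hcont : ∀ b, ContinuousOn (fun s => p s - N s * u s) (Icc 0 b) := fun b =>
    (h b).continuousOn_snd.sub ((hN.mono Icc_subset_Ici_self).mul (h b).continuousOn_fst)
  by_cases hne : Z.Nonempty
  · obtain ⟨s₀, hs₀⟩ := hne
    set c := sInf Z with hc
    have hc0 : 0 ≤ c := le_csInf ⟨s₀, hs₀⟩ fun s hs => hs.1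
    have hlt : ∀ s, 0 ≤ s → s < c → N s * u s < p s := fun s hs hsc => by
      by_contra! hcon
      exact absurd (csInf_le hZb (⟨hs, hcon⟩ : s ∈ Z)) (not_le.2 hsc)
    set Z' : Set ℝ := Icc 0 s₀ ∩ (fun s => p s - N s * u s) ⁻¹' Iic 0 with hZ'
    have hZc : IsClosed Z' :=
      (hcont s₀).preimage_isClosed_of_isClosed isClosed_Icc isClosed_Iic
    have hZb' : BddBelow Z' := ⟨0, fun s hs => hs.1.1⟩
    have hmem : s₀ ∈ Z' := ⟨⟨hs₀.1, le_rfl⟩, by simpa using hs₀.2⟩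
    have hle : p c ≤ N c * u c := by
      have h1 : c = sInf Z' := by
        refine le_antisymm (csInf_le_csInf hZb ⟨s₀, hmem⟩ ?_) ?_
        · exact fun s hs => ⟨hs.1.1, by simpa using hs.2⟩
        · refine le_csInf ⟨s₀, hs₀⟩ fun s hs => ?_
          rcases le_total s s₀ with hss | hss
          · have : s ∈ Z' := ⟨⟨hs.1, hss⟩, by simpa using hs.2⟩
            exact csInf_le hZb' this
          · exact (csInf_le hZb' hmem).trans hss
      have h2 := hZc.csInf_mem ⟨s₀, hmem⟩ hZb'
      rw [← h1] at h2
      simpa using h2.2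
    have hcpos : 0 < c := by
      refine hc0.lt_of_ne fun h0 => ?_
      rw [← h0, hp, hu, mul_zero] at hle
      linarith
    have hge : N c * u c ≤ p c := by
      have h1 : Tendsto (fun s => p s - N s * u s) (𝓝[<] c) (𝓝 (p c - N c * u c)) :=
        (hcont c c ⟨hc0, le_rfl⟩).mono_left (nhdsWithin_le_iff.2
          (mem_of_superset (Ioo_mem_nhdsLT hcpos) Ioo_subset_Icc_self))
      have h2 := ge_of_tendsto h1 (b := 0) (by
        filter_upwards [Ioo_mem_nhdsLT hcpos] with s hs
        have := hlt s hs.1.le hs.2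
        linarith)
      linarith
    refine ⟨c, EReal.coe_pos.2 hcpos, fun s hs hsc => hlt s hs.le (EReal.coe_lt_coe_iff.1 hsc),
      fun c' hc' => ?_⟩
    rw [← EReal.coe_eq_coe_iff.1 hc']
    exact le_antisymm hle hge
  · rw [not_nonempty_iff_eq_empty] at hne
    refine ⟨⊤, EReal.zero_lt_top, fun s hs _ => ?_, fun c hc => absurd hc.symm (EReal.coe_ne_top c)⟩
    by_contra! hcon
    have : s ∈ Z := ⟨hs.le, hcon⟩
    rw [hne] at this
    exact this

namespace IsFirstRobinPoint

variable {N u p : ℝ → ℝ} {A : EReal}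

theorem le (hA : IsFirstRobinPoint N u p A) {s : ℝ} (hs : 0 < s) (hsA : (s : EReal) ≤ A) :
    N s * u s ≤ p s := by
  rcases hsA.lt_or_eq with h | h
  · exact (hA.lt s hs h).le
  · exact (hA.eq s h.symm).ge

theorem snd_pos (hA : IsFirstRobinPoint N u p A) (h : ∀ b, IsFlow id N 1 b u p)
    (hN : ∀ s, 0 ≤ s → 0 < N s) (hu : u 0 = 0) (hp : p 0 = 1) {s : ℝ} (hs : 0 ≤ s)
    (hsA : (s : EReal) ≤ A) : 0 < p s :=
  (h s).snd_pos hu hp (fun _ ht => hN _ ht.1)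
    (fun _ ht => hA.le ht.1 ((EReal.coe_le_coe_iff.2 ht.2).trans hsA)) s ⟨hs, le_rfl⟩

theorem fst_pos (hA : IsFirstRobinPoint N u p A) (h : ∀ b, IsFlow id N 1 b u p)
    (hN : ∀ s, 0 ≤ s → 0 < N s) (hu : u 0 = 0) (hp : p 0 = 1) {s : ℝ} (hs : 0 < s)
    (hsA : (s : EReal) ≤ A) : 0 < u s :=
  (h s).fst_pos hu (fun _ ht => hN _ ht.1) le_rfl
    (fun _ ht => hA.snd_pos h hN hu hp ht.1 ((EReal.coe_le_coe_iff.2 ht.2.le).trans hsA)) s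
    ⟨hs, le_rfl⟩

theorem lambdaDR_pos (hμ : ContDiffOn ℝ 1 μ (Ici 0)) (hμ0 : ∀ s, 0 ≤ s → 0 < μ s)
    (hA : IsFirstRobinPoint (fun s => μ s ^ 2) u p A)
    (h : ∀ b, IsFlow id (fun s => μ s ^ 2) 1 b u p) (hu : u 0 = 0) (hp : p 0 = 1) {a : ℝ}
    (ha : 0 < a) (haA : (a : EReal) < A) : 0 < lambdaDR μ a := by
  have hN : ∀ s, 0 ≤ s → 0 < μ s ^ 2 := fun s hs => pow_pos (hμ0 s hs) 2
  obtain ⟨k, hk, f, g, hfg, hf, hg, hpos, hrob⟩ := exists_robin_parameter ha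
    ((hμ.continuousOn.pow 2).mono Icc_subset_Ici_self) (fun s hs => hN s hs.1) (h a) hu hp
    (fun s hs => hA.snd_pos h hN hu hp hs.1 ((EReal.coe_le_coe_iff.2 hs.2).trans haA.le))
    (hA.lt a ha haA)
  rw [lambdaDR_eq hμ hμ0 ha hfg hf hg hpos hrob]
  linarith

theorem lambdaDR_eq_zero (hμ : ContDiffOn ℝ 1 μ (Ici 0)) (hμ0 : ∀ s, 0 ≤ s → 0 < μ s)
    {c : ℝ} (hA : IsFirstRobinPoint (fun s => μ s ^ 2) u p c)
    (h : ∀ b, IsFlow id (fun s => μ s ^ 2) 1 b u p) (hu : u 0 = 0) (hp : p 0 = 1) :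
    lambdaDR μ c = 0 := by
  have hN : ∀ s, 0 ≤ s → 0 < μ s ^ 2 := fun s hs => pow_pos (hμ0 s hs) 2
  rw [lambdaDR_eq hμ hμ0 (EReal.coe_pos.1 hA.pos) (h c) hu hp
    (fun s hs => hA.snd_pos h hN hu hp hs.1 (EReal.coe_le_coe_iff.2 hs.2)) (hA.eq c rfl), sub_self]

theorem aStar_eq (hμ : ContDiffOn ℝ 1 μ (Ici 0)) (hμ0 : ∀ s, 0 ≤ s → 0 < μ s)
    (hA : IsFirstRobinPoint (fun s => μ s ^ 2) u p A)
    (h : ∀ b, IsFlow id (fun s => μ s ^ 2) 1 b u p) (hu : u 0 = 0) (hp : p 0 = 1) :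
    aStar μ = A := by
  refine le_antisymm (sSup_le ?_) (le_of_forall_lt fun y hy => ?_)
  · rintro _ ⟨c', ⟨hc', hpos⟩, rfl⟩
    by_contra! hcon
    induction A with
    | bot => exact absurd hA.pos (by simp)
    | top => exact absurd hcon (by simp)
    | coe c =>
      have := hpos c (EReal.coe_pos.1 hA.pos) (EReal.coe_lt_coe_iff.1 hcon)
      rw [hA.lambdaDR_eq_zero hμ hμ0 h hu hp] at this
      exact lt_irrefl _ this
  · obtain ⟨c, hc, hcA⟩ := EReal.lt_iff_exists_real_btwn.1 (max_lt hy hA.pos)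
    refine (le_max_left _ _).trans_lt (hc.trans_le (le_sSup ⟨c, ⟨?_, fun a ha hac => ?_⟩, rfl⟩))
    · exact EReal.coe_pos.1 ((le_max_right _ _).trans_lt hc)
    · exact hA.lambdaDR_pos hμ hμ0 h hu hp ha ((EReal.coe_lt_coe_iff.2 hac).trans hcA)

end IsFirstRobinPoint

end Weight

/-! ### The multiplier and the bound of an orbit -/

theorem IsFlow.continuousOn_energy {N : ℝ → ℝ} {k b : ℝ} {u p : ℝ → ℝ} (h : IsFlow id N k b u p)
    (hNc : ContinuousOn N (Icc 0 b)) (hN : ∀ s ∈ Icc 0 b, 0 < N s) :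
    ContinuousOn (fun s => p s ^ 2 / N s - k * N s * u s ^ 2) (Icc 0 b) :=
  ((h.continuousOn_snd.pow 2).div hNc fun s hs => (hN s hs).ne').sub
    ((continuousOn_const.mul hNc).mul (h.continuousOn_fst.pow 2))

/-- The energy of a solution is a boundary term, since `(p u)' = p² / N - k N u²`. -/
theorem IsFlow.integral_energy {N : ℝ → ℝ} {k b : ℝ} {u p : ℝ → ℝ} (h : IsFlow id N k b u p)
    (hb : 0 ≤ b) (hNc : ContinuousOn N (Icc 0 b)) (hN : ∀ s ∈ Icc 0 b, 0 < N s) (hu : u 0 = 0) :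
    ∫ s in (0 : ℝ)..b, (p s ^ 2 / N s - k * N s * u s ^ 2) = p b * u b := by
  have hd : ∀ s ∈ Icc 0 b, HasDerivWithinAt (fun s => p s * u s)
      (p s ^ 2 / N s - k * N s * u s ^ 2) (Icc 0 b) s := by
    intro s hs
    refine ((h s hs).2.mul (h s hs).1).congr_deriv ?_
    simp only [id]
    ring
  have := eq_integral_of_hasDerivWithinAt_Icc (h.continuousOn_energy hNc hN) hd b ⟨hb, le_rfl⟩
  simp only [hu, mul_zero, zero_add] at this
  exact this.symm

/-- A function continuous on `[α, β]`, extended by its boundary values, is continuous and bounded. -/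
theorem continuous_clamp {g : ℝ → ℝ} {α β : ℝ} (hαβ : α ≤ β) (hg : ContinuousOn g (Icc α β)) :
    Continuous (fun s => g (max α (min s β))) ∧ ∃ B, ∀ s, |g (max α (min s β))| ≤ B := by
  have hmem : ∀ s, max α (min s β) ∈ Icc α β := fun s =>
    ⟨le_max_left _ _, max_le hαβ (min_le_right _ _)⟩
  refine ⟨hg.comp_continuous (by fun_prop) hmem, ?_⟩
  obtain ⟨B, hB⟩ := isCompact_Icc.exists_bound_of_continuousOn hg
  exact ⟨B, fun s => hB _ (hmem s)⟩

/-- The multiplier of the main estimate: a solution `u` on `[0, a]`, the neutral exponential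
`e^{r s}` on `[a, t - b]`, the reflected momentum `p(t - s)` on `[t - b, t]`, and a constant
beyond `t`. It is written as a product of three factors, each of which moves on one interval. -/
def cutoff (u p : ℝ → ℝ) (r a b t s : ℝ) : ℝ :=
  u (max 0 (min s a)) / u a * Real.exp (r * (max a (min s (t - b)) - a)) *
    (p (t - max (t - b) (min s t)) / p b)

/-- The right derivative of `cutoff`, if `u' = p / N` and `p' = -r² N u`. -/
def cutoffDeriv (N u p : ℝ → ℝ) (r a b t s : ℝ) : ℝ :=
  if s < a then p (max 0 (min s a)) / N (max 0 (min s a)) / u a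
  else if s < t - b then r * Real.exp (r * (max a (min s (t - b)) - a))
  else if s < t then Real.exp (r * (t - b - a)) *
    (r ^ 2 * N (t - max (t - b) (min s t)) * u (t - max (t - b) (min s t)) / p b)
  else 0

section Cutoff

variable {N u p : ℝ → ℝ} {r a b t : ℝ}

theorem cutoff_of_le_left (hab : a + b < t) (hb : 0 < b) (hpb : p b ≠ 0) {s : ℝ}
    (h0 : 0 ≤ s) (hs : s ≤ a) : cutoff u p r a b t s = u s / u a := by
  rw [cutoff, min_eq_left hs, max_eq_right h0, min_eq_left (by linarith : s ≤ t - b),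
    max_eq_left hs, min_eq_left (by linarith : s ≤ t), max_eq_left (by linarith : s ≤ t - b),
    sub_sub_cancel, div_self hpb]
  simp

theorem cutoff_of_mem_middle (ha : 0 < a) (hb : 0 < b) (hua : u a ≠ 0) (hpb : p b ≠ 0) {s : ℝ}
    (h0 : a ≤ s) (hs : s ≤ t - b) : cutoff u p r a b t s = Real.exp (r * (s - a)) := by
  rw [cutoff, min_eq_right h0, max_eq_right ha.le, min_eq_left hs, max_eq_right h0,
    min_eq_left (by linarith : s ≤ t), max_eq_left hs, sub_sub_cancel, div_self hpb,
    div_self hua]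
  simp

theorem cutoff_of_mem_right (ha : 0 < a) (hab : a + b < t) (hua : u a ≠ 0)
    {s : ℝ} (h0 : t - b ≤ s) (hs : s ≤ t) :
    cutoff u p r a b t s = Real.exp (r * (t - b - a)) * (p (t - s) / p b) := by
  rw [cutoff, min_eq_right (by linarith : a ≤ s), max_eq_right ha.le, min_eq_right h0,
    max_eq_right (by linarith : a ≤ t - b), min_eq_left hs, max_eq_right h0, div_self hua, one_mul]

theorem cutoff_of_ge (ha : 0 < a) (hb : 0 < b) (hab : a + b < t) (hua : u a ≠ 0)
    {s : ℝ} (hs : t ≤ s) :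
    cutoff u p r a b t s = Real.exp (r * (t - b - a)) * (p 0 / p b) := by
  rw [cutoff, min_eq_right (by linarith : a ≤ s), max_eq_right ha.le,
    min_eq_right (by linarith : t - b ≤ s), max_eq_right (by linarith : a ≤ t - b),
    min_eq_right hs, max_eq_right (by linarith : t - b ≤ t), div_self hua, one_mul, sub_self]

theorem cutoffDeriv_of_lt {s : ℝ} (h0 : 0 ≤ s) (hs : s < a) :
    cutoffDeriv N u p r a b t s = p s / N s / u a := by
  rw [cutoffDeriv, if_pos hs, min_eq_left hs.le, max_eq_right h0]

theorem cutoffDeriv_of_mem_middle {s : ℝ} (h0 : a ≤ s) (hs : s < t - b) :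
    cutoffDeriv N u p r a b t s = r * Real.exp (r * (s - a)) := by
  rw [cutoffDeriv, if_neg (not_lt.2 h0), if_pos hs, min_eq_left hs.le, max_eq_right h0]

theorem cutoffDeriv_of_mem_right {s : ℝ} (hab : a + b < t) (h0 : t - b ≤ s) (hs : s < t) :
    cutoffDeriv N u p r a b t s =
      Real.exp (r * (t - b - a)) * (r ^ 2 * N (t - s) * u (t - s) / p b) := by
  rw [cutoffDeriv, if_neg (by linarith), if_neg (by linarith), if_pos hs, min_eq_left hs.le,
    max_eq_right h0]

theorem cutoffDeriv_of_ge {s : ℝ} (hb : 0 < b) (hab : a + b < t) (hs : t ≤ s) :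
    cutoffDeriv N u p r a b t s = 0 := by
  rw [cutoffDeriv, if_neg (by linarith), if_neg (by linarith), if_neg (by linarith)]

theorem exists_isCutoff_cutoff (h : ∀ T, IsFlow id N (r ^ 2) T u p) (hNc : ContinuousOn N (Ici 0))
    (hN : ∀ s, 0 ≤ s → 0 < N s) (hu : u 0 = 0) (ha : 0 < a) (hb : 0 < b) (hab : a + b < t)
    (hua : u a ≠ 0) (hpb : p b ≠ 0) :
    ∃ B, StrongSemigroup.IsCutoff (cutoff u p r a b t) (cutoffDeriv N u p r a b t) B := by
  have hatb : a ≤ t - b := by linarith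
  have htb : t - b ≤ t := by linarith
  have hrefl : ∀ y : ℝ → ℝ, ContinuousOn y (Icc 0 b) →
      ContinuousOn (fun s => y (t - s)) (Icc (t - b) t) := fun y hy =>
    hy.comp (by fun_prop) fun s hs => ⟨by linarith [hs.2], by linarith [hs.1]⟩
  obtain ⟨c₁, B₁, hB₁⟩ := continuous_clamp ha.le
    ((h a).continuousOn_fst.div_const (u a))
  obtain ⟨c₂, B₂, hB₂⟩ := continuous_clamp (g := fun s => Real.exp (r * (s - a))) hatb
    (by fun_prop)
  obtain ⟨c₃, B₃, hB₃⟩ := continuous_clamp htb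
    (hrefl (fun s => p s / p b) ((h b).continuousOn_snd.div_const (p b)))
  obtain ⟨d₁, D₁, hD₁⟩ := continuous_clamp ha.le
    (((h a).continuousOn_snd.div (hNc.mono Icc_subset_Ici_self)
      fun s hs => (hN s hs.1).ne').div_const (u a))
  obtain ⟨d₂, D₂, hD₂⟩ := continuous_clamp (g := fun s => r * Real.exp (r * (s - a))) hatb
    (by fun_prop)
  obtain ⟨d₃, D₃, hD₃⟩ := continuous_clamp htb (continuousOn_const.mul
    (hrefl (fun s => r ^ 2 * N s * u s / p b)
    (((continuousOn_const.mul (hNc.mono Icc_subset_Ici_self)).mul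
      (h b).continuousOn_fst).div_const (p b))) :
    ContinuousOn (fun s => Real.exp (r * (t - b - a)) * (r ^ 2 * N (t - s) * u (t - s) / p b))
      (Icc (t - b) t))
  have hB₁0 := (abs_nonneg _).trans (hB₁ 0)
  have hB₂0 := (abs_nonneg _).trans (hB₂ 0)
  have hB₃0 := (abs_nonneg _).trans (hB₃ 0)
  have hD₁0 := (abs_nonneg _).trans (hD₁ 0)
  have hD₂0 := (abs_nonneg _).trans (hD₂ 0)
  have hD₃0 := (abs_nonneg _).trans (hD₃ 0)
  refine ⟨B₁ * B₂ * B₃ + D₁ + D₂ + D₃, ⟨(c₁.mul c₂).mul c₃, ?_, ?_, fun s => ?_, fun s => ?_,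
    fun s hs => ?_⟩⟩
  · refine Measurable.ite measurableSet_Iio d₁.measurable
      (Measurable.ite measurableSet_Iio d₂.measurable
        (Measurable.ite measurableSet_Iio d₃.measurable measurable_const))
  · rw [cutoff_of_le_left hab hb hpb le_rfl ha.le, hu, zero_div]
  · have : |cutoff u p r a b t s| ≤ B₁ * B₂ * B₃ := by
      rw [cutoff, abs_mul, abs_mul]
      exact mul_le_mul (mul_le_mul (hB₁ s) (hB₂ s) (abs_nonneg _) hB₁0) (hB₃ s) (abs_nonneg _)
        (mul_nonneg hB₁0 hB₂0)
    linarith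
  · have h0 : 0 ≤ B₁ * B₂ * B₃ := by positivity
    rw [cutoffDeriv]
    split_ifs
    · exact (hD₁ s).trans (by linarith)
    · exact (hD₂ s).trans (by linarith)
    · exact (hD₃ s).trans (by linarith)
    · rw [abs_zero]; linarith
  · rcases lt_or_ge s a with hsa | hsa
    · rw [cutoffDeriv_of_lt hs.le hsa]
      have h1 := ((h a s ⟨hs.le, hsa.le⟩).1.hasDerivAt (Icc_mem_nhds hs hsa)).div_const (u a)
      refine h1.hasDerivWithinAt.congr_of_eventuallyEq ?_ ?_
      · filter_upwards [Ioo_mem_nhdsGT hsa] with y hy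
        exact cutoff_of_le_left hab hb hpb (hs.trans hy.1).le hy.2.le
      · exact cutoff_of_le_left hab hb hpb hs.le hsa.le
    rcases lt_or_ge s (t - b) with hsb | hsb
    · rw [cutoffDeriv_of_mem_middle hsa hsb]
      have h1 : HasDerivAt (fun s => Real.exp (r * (s - a))) (r * Real.exp (r * (s - a))) s := by
        have := (((hasDerivAt_id s).sub_const a).const_mul r).exp
        refine this.congr_deriv ?_
        simp [mul_comm]
      refine h1.hasDerivWithinAt.congr_of_eventuallyEq ?_ ?_
      · filter_upwards [Ioo_mem_nhdsGT hsb] with y hy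
        exact cutoff_of_mem_middle ha hb hua hpb (hsa.trans hy.1.le) hy.2.le
      · exact cutoff_of_mem_middle ha hb hua hpb hsa hsb.le
    rcases lt_or_ge s t with hst | hst
    · rw [cutoffDeriv_of_mem_right hab hsb hst]
      have h1 := (h (b + 1) (t - s) ⟨by linarith, by linarith⟩).2.hasDerivAt
        (Icc_mem_nhds (by linarith) (by linarith))
      have h2 : HasDerivAt (fun y => Real.exp (r * (t - b - a)) * (p (t - y) / p b))
          (Real.exp (r * (t - b - a)) * (r ^ 2 * N (t - s) * u (t - s) / p b)) s := by
        have := ((h1.comp_const_sub t s).div_const (p b)).const_mul (Real.exp (r * (t - b - a)))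
        refine this.congr_deriv ?_
        rw [neg_neg]
      refine h2.hasDerivWithinAt.congr_of_eventuallyEq ?_ ?_
      · filter_upwards [Ioo_mem_nhdsGT hst] with y hy
        exact cutoff_of_mem_right ha hab hua (hsb.trans hy.1.le) hy.2.le
      · exact cutoff_of_mem_right ha hab hua hsb hst.le
    · rw [cutoffDeriv_of_ge hb hab hst]
      refine (hasDerivWithinAt_const s (Ioi s) _).congr_of_eventuallyEq ?_
        (cutoff_of_ge ha hb hab hua hst)
      filter_upwards [self_mem_nhdsWithin] with y hy
      exact cutoff_of_ge ha hb hab hua (hst.trans (le_of_lt hy))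

end Cutoff

/-- The energy inequality for the multiplier `cutoff` bounds the orbit at time `t`. -/
theorem StrongSemigroup.orbit_le {H : Type*} [NormedAddCommGroup H] [InnerProductSpace ℂ H]
    [CompleteSpace H] {S : StrongSemigroup H} {ω r : ℝ}
    (hr : S.HasResolventRadius ω r) {m : ℝ → ℝ} (hm : ContinuousOn m (Ici 0))
    (hpos : ∀ t : ℝ, 0 ≤ t → 0 < m t) (hS : ∀ t : ℝ, 0 < t → ‖S.toFun t‖ ≤ m t)
    {N u p : ℝ → ℝ} (hNm : ∀ s, N s = (Real.exp (-(ω * s)) * m s) ^ 2)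
    (h : ∀ T, IsFlow id N (r ^ 2) T u p) (hu : u 0 = 0) {a b t : ℝ} (ha : 0 < a) (hb : 0 < b)
    (hab : a + b < t) (hua : 0 < u a) (hub : 0 < u b) (hpb : 0 < p b)
    (hla : ∀ s ∈ Ioc 0 a, 0 < u s ∧ r * N s * u s ≤ p s)
    (hlb : ∀ s ∈ Ioc 0 b, 0 < u s ∧ r * N s * u s ≤ p s) (x : H) :
    (Real.exp (-(ω * t)) * ‖S.toFun t x‖) ^ 2 ≤
      Real.exp (-(2 * r * (t - (a + b)))) * (p a / (r * u a)) * (p b / (r * u b)) * ‖x‖ ^ 2 := by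
  have hr0 := hr.1
  have hN : ∀ s, 0 ≤ s → 0 < N s := fun s hs => by
    rw [hNm]; exact pow_pos (mul_pos (Real.exp_pos _) (hpos s hs)) 2
  have hNc : ContinuousOn N (Ici 0) :=
    ((((by fun_prop : Continuous fun s : ℝ => Real.exp (-(ω * s))).continuousOn).mul hm).pow
      2).congr fun s _ => hNm s
  obtain ⟨B, hB⟩ := exists_isCutoff_cutoff h hNc hN hu ha hb hab hua.ne' hpb.ne'
  obtain ⟨hJi, hJ⟩ := S.energy_inequality hr hm hS x hB
  set G : ℝ → ℝ := fun s => (Real.exp (-(ω * s)) * ‖S.toFun s x‖) ^ 2 with hG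
  set χ := cutoff u p r a b t with hχ
  set χ' := cutoffDeriv N u p r a b t with hχ'
  set J : ℝ → ℝ := fun s => (r ^ 2 * χ s ^ 2 - χ' s ^ 2) * G s with hJdef
  set E := Real.exp (r * (t - b - a)) with hE
  have hE0 : 0 < E := Real.exp_pos _
  have hatb : a ≤ t - b := by linarith
  have htb : t - b ≤ t := by linarith
  have hG0 : ∀ s, 0 ≤ G s := fun s => sq_nonneg _
  -- growth of the orbit forwards in time, measured by the weight
  have hGx : ∀ s, 0 < s → G s ≤ N s * ‖x‖ ^ 2 := by
    intro s hs
    rw [hNm, ← mul_pow]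
    refine pow_le_pow_left₀ (by positivity) ?_ 2
    rw [mul_assoc]
    refine mul_le_mul_of_nonneg_left ?_ (Real.exp_pos _).le
    exact ((S.toFun s).le_opNorm x).trans (mul_le_mul_of_nonneg_right (hS s hs) (norm_nonneg _))
  have hGt : ∀ s, 0 < s → s < t → G t ≤ N (t - s) * G s := by
    intro s hs hst
    rw [hNm]
    simp only [hG]
    rw [← mul_pow]
    refine pow_le_pow_left₀ (by positivity) ?_ 2
    have e1 := congrArg (fun A => A x) (S.map_add (t - s) s (by linarith) hs.le)
    simp only [ContinuousLinearMap.comp_apply, sub_add_cancel] at e1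
    have e2 : Real.exp (-(ω * t)) = Real.exp (-(ω * (t - s))) * Real.exp (-(ω * s)) := by
      rw [← Real.exp_add]; congr 1; ring
    have e3 : ‖S.toFun t x‖ ≤ m (t - s) * ‖S.toFun s x‖ := by
      rw [e1]
      exact ((S.toFun (t - s)).le_opNorm _).trans
        (mul_le_mul_of_nonneg_right (hS _ (by linarith)) (norm_nonneg _))
    rw [e2]
    calc _ ≤ Real.exp (-(ω * (t - s))) * Real.exp (-(ω * s)) * (m (t - s) * ‖S.toFun s x‖) := by
          gcongr
      _ = _ := by ring
  have hII : ∀ c d : ℝ, 0 ≤ c → c ≤ d → IntervalIntegrable J volume c d := fun c d hc hcd => by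
    rw [intervalIntegrable_iff_integrableOn_Ioc_of_le hcd]
    exact hJi.mono_set fun s hs => lt_of_le_of_lt hc hs.1
  have hsplit : ∫ s in Ioi 0, J s = (∫ s in (0 : ℝ)..a, J s) + (∫ s in a..(t - b), J s) +
      (∫ s in (t - b)..t, J s) + ∫ s in Ioi t, J s := by
    rw [intervalIntegral.integral_add_adjacent_intervals (hII 0 a le_rfl ha.le)
      (hII a (t - b) ha.le hatb), intervalIntegral.integral_add_adjacent_intervals
      (hII 0 (t - b) le_rfl (by linarith)) (hII (t - b) t (by linarith) htb),
      intervalIntegral.integral_of_le (by linarith), ← setIntegral_union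
      (Ioc_disjoint_Ioi le_rfl) measurableSet_Ioi (hJi.mono_set Ioc_subset_Ioi_self)
      (hJi.mono_set (Ioi_subset_Ioi (by linarith))), Ioc_union_Ioi_eq_Ioi (by linarith)]
  have h4 : 0 ≤ ∫ s in Ioi t, J s := by
    refine setIntegral_nonneg measurableSet_Ioi fun s hs => ?_
    simp only [hJdef, hχ']
    rw [cutoffDeriv_of_ge hb hab (le_of_lt hs), zero_pow two_ne_zero, sub_zero]
    have := hG0 s
    positivity
  have h2 : 0 ≤ ∫ s in a..(t - b), J s := by
    have := intervalIntegral.integral_mono_on_of_le_Ioo (f := fun _ => (0 : ℝ)) (g := J) hatb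
      intervalIntegrable_const (hII a (t - b) ha.le hatb) fun s hs => by
        simp only [hJdef, hχ, hχ']
        rw [cutoff_of_mem_middle ha hb hua.ne' hpb.ne' hs.1.le hs.2.le,
          cutoffDeriv_of_mem_middle hs.1.le hs.2, mul_pow, sub_self, zero_mul]
    simpa using this
  have h1 : -(‖x‖ ^ 2 * (p a / u a)) ≤ ∫ s in (0 : ℝ)..a, J s := by
    have hNa : ContinuousOn N (Icc 0 a) := hNc.mono Icc_subset_Ici_self
    have hNa' : ∀ s ∈ Icc 0 a, 0 < N s := fun s hs => hN s hs.1
    have h5 := intervalIntegral.integral_mono_on_of_le_Ioo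
      (f := fun s => -(‖x‖ ^ 2 / u a ^ 2) * (p s ^ 2 / N s - r ^ 2 * N s * u s ^ 2)) (g := J)
      ha.le (((h a).continuousOn_energy hNa hNa').intervalIntegrable_of_Icc ha.le |>.const_mul _)
      (hII 0 a le_rfl ha.le) fun s hs => by
        obtain ⟨hus, hle⟩ := hla s (Ioo_subset_Ioc_self hs)
        have hNs := hN s hs.1.le
        simp only [hJdef, hχ, hχ']
        rw [cutoff_of_le_left hab hb hpb.ne' hs.1.le hs.2.le, cutoffDeriv_of_lt hs.1.le hs.2]
        have hsq : (r * N s * u s) ^ 2 ≤ p s ^ 2 := by gcongr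
        have h6 : 0 ≤ (p s / N s / u a) ^ 2 - r ^ 2 * (u s / u a) ^ 2 := by
          have : (p s / N s / u a) ^ 2 - r ^ 2 * (u s / u a) ^ 2 =
              (p s ^ 2 - (r * N s * u s) ^ 2) / (N s ^ 2 * u a ^ 2) := by
            field_simp
          rw [this]
          exact div_nonneg (by linarith) (by positivity)
        have h7 := mul_le_mul_of_nonneg_left (hGx s hs.1) h6
        have h8 : -(‖x‖ ^ 2 / u a ^ 2) * (p s ^ 2 / N s - r ^ 2 * N s * u s ^ 2) =
            -(((p s / N s / u a) ^ 2 - r ^ 2 * (u s / u a) ^ 2) * (N s * ‖x‖ ^ 2)) := by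
          field_simp
        rw [h8]
        linarith
    rw [intervalIntegral.integral_const_mul, (h a).integral_energy ha.le hNa hNa' hu] at h5
    refine le_trans (le_of_eq ?_) h5
    field_simp
  have h3 : E ^ 2 * r ^ 2 * (u b / p b) * G t ≤ ∫ s in (t - b)..t, J s := by
    have hNb : ContinuousOn N (Icc 0 b) := hNc.mono Icc_subset_Ici_self
    have hNb' : ∀ s ∈ Icc 0 b, 0 < N s := fun s hs => hN s hs.1
    set e : ℝ → ℝ := fun τ => E ^ 2 * r ^ 2 / p b ^ 2 * G t *
      (p τ ^ 2 / N τ - r ^ 2 * N τ * u τ ^ 2) with he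
    have hei : ContinuousOn e (Icc 0 b) :=
      continuousOn_const.mul ((h b).continuousOn_energy hNb hNb')
    have hei' : IntervalIntegrable (fun s => e (t - s)) volume (t - b) t := by
      refine ContinuousOn.intervalIntegrable_of_Icc htb (hei.comp (by fun_prop) fun s hs => ?_)
      exact ⟨by linarith [hs.2], by linarith [hs.1]⟩
    have h5 := intervalIntegral.integral_mono_on_of_le_Ioo (f := fun s => e (t - s)) (g := J) htb
      hei' (hII (t - b) t (by linarith) htb) fun s hs => by
        have hτ : t - s ∈ Ioc 0 b := ⟨by linarith [hs.2], by linarith [hs.1]⟩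
        have hs0 : 0 < s := by linarith [hs.1]
        obtain ⟨hus, hle⟩ := hlb _ hτ
        have hNs := hN _ hτ.1.le
        simp only [hJdef, hχ, hχ', he]
        rw [cutoff_of_mem_right ha hab hua.ne' hs.1.le hs.2.le,
          cutoffDeriv_of_mem_right hab hs.1.le hs.2, ← hE]
        have hsq : (r * N (t - s) * u (t - s)) ^ 2 ≤ p (t - s) ^ 2 := by gcongr
        have h7 := hGt s hs0 hs.2
        have h8 : 0 ≤ E ^ 2 * r ^ 2 / p b ^ 2 *
            ((p (t - s) ^ 2 - (r * N (t - s) * u (t - s)) ^ 2) / N (t - s)) :=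
          mul_nonneg (by positivity) (div_nonneg (by linarith) hNs.le)
        have h9 := mul_le_mul_of_nonneg_left h7 h8
        calc _ = E ^ 2 * r ^ 2 / p b ^ 2 *
            ((p (t - s) ^ 2 - (r * N (t - s) * u (t - s)) ^ 2) / N (t - s)) * G t := by
              field_simp
          _ ≤ _ := h9
          _ = _ := by field_simp
    rw [intervalIntegral.integral_comp_sub_left e t, sub_self, sub_sub_cancel,
      intervalIntegral.integral_const_mul, (h b).integral_energy hb.le hNb hNb' hu] at h5
    refine le_trans (le_of_eq ?_) h5
    field_simp
  have hfin : E ^ 2 * r ^ 2 * (u b / p b) * G t ≤ ‖x‖ ^ 2 * (p a / u a) := by linarith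
  have hE2 : Real.exp (-(2 * r * (t - (a + b)))) = (E ^ 2)⁻¹ := by
    rw [hE, ← Real.exp_nat_mul, ← Real.exp_neg]
    congr 1
    push_cast
    ring
  rw [hE2]
  change G t ≤ _
  calc G t = (E ^ 2 * r ^ 2 * (u b / p b) * G t) * ((E ^ 2)⁻¹ * (p b / (r ^ 2 * u b))) := by
        field_simp
    _ ≤ ‖x‖ ^ 2 * (p a / u a) * ((E ^ 2)⁻¹ * (p b / (r ^ 2 * u b))) := by gcongr
    _ = _ := by field_simp

/-! ### Rescaling, uniqueness and optimality -/

theorem IsFlow.comp_mul {N u p : ℝ → ℝ} (h : ∀ T, IsFlow id N 1 T u p) {r : ℝ} (hr : 0 < r)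
    (T : ℝ) :
    IsFlow id (fun s => N (r * s)) (r ^ 2) T (fun s => u (r * s)) (fun s => r * p (r * s)) := by
  intro s hs
  have hmaps : MapsTo (fun s => r * s) (Icc 0 T) (Icc 0 (r * T)) := fun t ht =>
    ⟨mul_nonneg hr.le ht.1, mul_le_mul_of_nonneg_left ht.2 hr.le⟩
  have hid : HasDerivWithinAt (fun s => r * s) r (Icc 0 T) s := by
    simpa using (hasDerivWithinAt_id s (Icc 0 T)).const_mul r
  obtain ⟨h1, h2⟩ := h (r * T) (r * s) (hmaps hs)
  constructor
  · refine (h1.comp s hid hmaps).congr_deriv ?_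
    simp only [id]
    ring
  · refine ((h2.comp s hid hmaps).const_mul r).congr_deriv ?_
    ring

/-- The division of a positive extended real number by `r`, with the order relations it satisfies. -/
theorem exists_ereal_div {r : ℝ} (hr : 0 < r) {A : EReal} (hA : 0 < A) :
    ∃ B : EReal, (r : EReal) * B = A ∧ 0 < B ∧ (∀ s : ℝ, (s : EReal) < B ↔ ((r * s : ℝ) : EReal) < A) ∧
      ∀ c : ℝ, B = c ↔ A = (r * c : ℝ) := by
  induction A with
  | bot => exact absurd hA (by simp)
  | top =>
    refine ⟨⊤, EReal.coe_mul_top_of_pos hr, EReal.zero_lt_top, fun s => ?_, fun c => ?_⟩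
    · exact ⟨fun _ => EReal.coe_lt_top _, fun _ => EReal.coe_lt_top _⟩
    · exact ⟨fun h => absurd h.symm (EReal.coe_ne_top c),
        fun h => absurd h.symm (EReal.coe_ne_top _)⟩
  | coe a =>
    have ha : 0 < a := EReal.coe_pos.1 hA
    refine ⟨(a / r : ℝ), ?_, EReal.coe_pos.2 (div_pos ha hr), fun s => ?_, fun c => ?_⟩
    · rw [← EReal.coe_mul, mul_div_cancel₀ _ hr.ne']
    · rw [EReal.coe_lt_coe_iff, EReal.coe_lt_coe_iff, lt_div_iff₀ hr, mul_comm]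
    · rw [EReal.coe_eq_coe_iff, EReal.coe_eq_coe_iff, div_eq_iff hr.ne', mul_comm]

section Hat

variable {M : ℝ → ℝ} {r : ℝ}

/-- The pair `(A, ψ)` is determined by the solution `u`, because two solutions that vanish at `0`
have the same logarithmic derivative. -/
theorem hatPair_unique (hM0 : ∀ s, 0 ≤ s → 0 < M s) (hr : 0 < r) {u v u' v' : ℝ → ℝ}
    (h : ∀ b, 0 < b → IsFlow id (fun s => M s ^ 2) (r ^ 2) b u (fun s => M s ^ 2 * v s))
    (hu : u 0 = 0)
    (h' : ∀ b, 0 < b → IsFlow id (fun s => M s ^ 2) (r ^ 2) b u' (fun s => M s ^ 2 * v' s))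
    (hu' : u' 0 = 0) {A A' : EReal} (hA : 0 < A) (hA' : 0 < A')
    (hlt : ∀ s : ℝ, 0 < s → (s : EReal) < A → 0 < u s ∧ u s < v s / r)
    (heq : ∀ c : ℝ, A = c → 0 < u c ∧ v c / r = u c)
    (hlt' : ∀ s : ℝ, 0 < s → (s : EReal) < A' → 0 < u' s ∧ u' s < v' s / r)
    (heq' : ∀ c : ℝ, A' = c → 0 < u' c ∧ v' c / r = u' c) :
    A' = A ∧ ∀ s : ℝ, 0 < s → (s : EReal) ≤ A → (v' s / r) / u' s = (v s / r) / u s := by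
  have hW : ∀ s, 0 < s → u s * v' s = u' s * v s := by
    intro s hs
    have h1 := (h s hs).wronskian hu (h' s hs) hu' s ⟨hs.le, le_rfl⟩
    have h2 := (pow_pos (hM0 s hs.le) 2).ne'
    apply mul_left_cancel₀ h2
    linarith
  have key : ∀ (u v u' v' : ℝ → ℝ) (A A' : EReal), 0 < A' →
      (∀ s, 0 < s → u s * v' s = u' s * v s) →
      (∀ s : ℝ, 0 < s → (s : EReal) < A → 0 < u s ∧ u s < v s / r) →
      (∀ c : ℝ, A' = c → 0 < u' c ∧ v' c / r = u' c) → A ≤ A' := by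
    intro u v u' v' A A' hA' hW hlt heq'
    by_contra! hcon
    induction A' with
    | bot => exact absurd hA' (by simp)
    | top => exact absurd hcon (by simp)
    | coe c =>
      have hc : 0 < c := EReal.coe_pos.1 hA'
      obtain ⟨h1, h2⟩ := hlt c hc hcon
      obtain ⟨h3, h4⟩ := heq' c rfl
      have h5 := hW c hc
      rw [div_eq_iff hr.ne'] at h4
      rw [lt_div_iff₀ hr] at h2
      rw [h4] at h5
      nlinarith
  have hAA : A' = A := le_antisymm
    (key u' v' u v A' A hA (fun s hs => (hW s hs).symm) hlt' heq)
    (key u v u' v' A A' hA' hW hlt heq')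
  refine ⟨hAA, fun s hs hsA => ?_⟩
  have hpos : 0 < u s ∧ 0 < u' s := by
    rcases hsA.lt_or_eq with h1 | h1
    · exact ⟨(hlt s hs h1).1, (hlt' s hs (hAA ▸ h1)).1⟩
    · exact ⟨(heq s h1.symm).1, (heq' s (hAA.trans h1.symm)).1⟩
  have h1 := hpos.1.ne'
  have h2 := hpos.2.ne'
  have := hW s hs
  rw [div_div, div_div, div_eq_div_iff (by positivity) (by positivity)]
  linear_combination r * this

/-- The quantity `e^{2 r s} m² ψ = e^{2 r s} p / (r u)` decreases along a solution: its derivative is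
`- r m² e^{2 r s} (ψ - 1)²`. -/
theorem IsFlow.exp_mul_ratio_antitone {N u p : ℝ → ℝ} {c : ℝ} (h : IsFlow id N (r ^ 2) c u p)
    (hr : 0 < r) (hN : ∀ s ∈ Icc 0 c, 0 < N s) (hu : ∀ s ∈ Ioc 0 c, 0 < u s) {a : ℝ}
    (ha : 0 < a) (hac : a ≤ c) :
    Real.exp (2 * r * c) * (p c / (r * u c)) ≤ Real.exp (2 * r * a) * (p a / (r * u a)) := by
  have hsub : Icc a c ⊆ Icc 0 c := Icc_subset_Icc_left ha.le
  have hd : ∀ s ∈ Icc a c, HasDerivWithinAt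
      (fun s => -(Real.exp (2 * r * s) * (p s / (r * u s))))
      (r / N s * Real.exp (2 * r * s) * (p s / (r * u s) - N s) ^ 2) (Icc 0 c) s := by
    intro s hs
    have hus := (hu s ⟨ha.trans_le hs.1, hs.2⟩).ne'
    have hNs := (hN s (hsub hs)).ne'
    obtain ⟨h1, h2⟩ := h s (hsub hs)
    have he : HasDerivWithinAt (fun s => Real.exp (2 * r * s)) (Real.exp (2 * r * s) * (2 * r))
        (Icc 0 c) s := by
      have := (((hasDerivAt_id s).const_mul (2 * r)).exp).hasDerivWithinAt (s := Icc 0 c)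
      simpa using this
    refine (he.mul (h2.div (h1.const_mul r) (mul_ne_zero hr.ne' hus))).neg.congr_deriv ?_
    simp only [id, Pi.div_apply]
    field_simp
    ring
  have := monotoneOn_Icc_of_hasDerivWithinAt hsub hd (fun s hs => by
    have := hN s (hsub hs)
    positivity) ⟨le_rfl, hac⟩ ⟨hac, le_rfl⟩ hac
  simpa using this

theorem hatBound_eq (ω r : ℝ) (m ψ : ℝ → ℝ) (t a b : ℝ) :
    hatBound ω r m ψ t a b = Real.exp ((ω - r) * t) *
      (Real.exp ((r - ω) * a) * m a * √(ψ a)) * (Real.exp ((r - ω) * b) * m b * √(ψ b)) := by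
  have : Real.exp ((ω - r) * (t - (a + b))) =
      Real.exp ((ω - r) * t) * Real.exp ((r - ω) * a) * Real.exp ((r - ω) * b) := by
    rw [← Real.exp_add, ← Real.exp_add]; congr 1; ring
  rw [hatBound, this]
  ring

theorem exp_mul_sqrt_eq {ω r s ms us ps : ℝ} (hr : 0 < r) (hms : 0 < ms) (hus : 0 < us) :
    Real.exp ((r - ω) * s) * ms * √(ps / (Real.exp (-(ω * s)) * ms) ^ 2 / r / us) =
      √(Real.exp (2 * r * s) * (ps / (r * us))) := by
  have h1 : Real.exp (2 * r * s) * (ps / (r * us)) = (Real.exp ((r - ω) * s) * ms) ^ 2 *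
      (ps / (Real.exp (-(ω * s)) * ms) ^ 2 / r / us) := by
    have h2 : Real.exp ((r - ω) * s) = Real.exp (r * s) * Real.exp (-(ω * s)) := by
      rw [← Real.exp_add]; congr 1; ring
    have h3 : Real.exp (2 * r * s) = Real.exp (r * s) ^ 2 := by
      rw [← Real.exp_nat_mul]; congr 1; push_cast; ring
    have h4 := (Real.exp_pos (-(ω * s))).ne'
    rw [h2, h3]
    field_simp
  rw [h1, Real.sqrt_mul (sq_nonneg _), Real.sqrt_sq (by positivity)]

end Hat

section FirstFunction

variable {μ u p : ℝ → ℝ} {A : EReal}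

theorem isFirstFunction_of_isFirstRobinPoint (hμ : ContDiffOn ℝ 1 μ (Ici 0)) (hμ0 : ∀ s, 0 ≤ s → 0 < μ s)
    (hA : IsFirstRobinPoint (fun s => μ s ^ 2) u p A)
    (h : ∀ b, IsFlow id (fun s => μ s ^ 2) 1 b u p) (hu : u 0 = 0) (hp : p 0 = 1) :
    IsFirstFunction μ u (fun s => p s / μ s ^ 2) := by
  have hN : ∀ s, 0 ≤ s → 0 < μ s ^ 2 := fun s hs => pow_pos (hμ0 s hs) 2
  have hflow : ∀ b, IsFlow id (fun s => μ s ^ 2) 1 b u (fun s => μ s ^ 2 * (p s / μ s ^ 2)) :=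
    fun b => (h b).congr (fun _ _ => rfl) fun s hs => mul_div_cancel₀ _ (hN s hs.1).ne'
  have hstar := hA.aStar_eq hμ hμ0 h hu hp
  refine ⟨fun a ha => ?_, fun ha => ?_⟩
  · have hAa : A = a := hstar ▸ ha
    subst hAa
    have ha0 := EReal.coe_pos.1 hA.pos
    rw [hA.lambdaDR_eq_zero hμ hμ0 h hu hp, isDREigenfunction_iff hμ hμ0 ha0, add_zero]
    refine ⟨hflow a, hu, ?_, a, ⟨ha0.le, le_rfl⟩, (hA.fst_pos h hN hu hp ha0 le_rfl).ne'⟩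
    rw [hA.eq a rfl, mul_div_cancel_left₀ _ (hN a ha0.le).ne']
  · have hAa : A = ⊤ := hstar ▸ ha
    subst hAa
    rw [isHarmonicFromZero_iff hμ hμ0 one_pos, one_pow]
    exact ⟨fun b _ => hflow b, hu, 1, one_pos, (hA.fst_pos h hN hu hp one_pos le_top).ne'⟩

theorem firstFunction_ratio (hμ : ContDiffOn ℝ 1 μ (Ici 0)) (hμ0 : ∀ s, 0 ≤ s → 0 < μ s)
    (hA : IsFirstRobinPoint (fun s => μ s ^ 2) u p A)
    (h : ∀ b, IsFlow id (fun s => μ s ^ 2) 1 b u p) (hu : u 0 = 0) (hp : p 0 = 1)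
    {f g : ℝ → ℝ} (hfg : IsFirstFunction μ f g) {s : ℝ} (hs : 0 < s) (hsA : (s : EReal) ≤ A) :
    p s / μ s ^ 2 / u s = g s / f s := by
  have hN : ∀ s, 0 ≤ s → 0 < μ s ^ 2 := fun s hs => pow_pos (hμ0 s hs) 2
  have hstar := hA.aStar_eq hμ hμ0 h hu hp
  -- on some interval containing `s`, the function `f` is a solution that does not vanish identically
  obtain ⟨b, hsb, hbA, hflow, hf, t, ht, hft⟩ : ∃ b, s ≤ b ∧ (b : EReal) ≤ A ∧
      IsFlow id (fun s => μ s ^ 2) 1 b f (fun s => μ s ^ 2 * g s) ∧ f 0 = 0 ∧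
      ∃ t ∈ Ioc 0 b, f t ≠ 0 := by
    induction A with
    | bot => exact absurd hA.pos (by simp)
    | top =>
      have h1 := hfg.2 hstar
      rw [isHarmonicFromZero_iff hμ hμ0 one_pos, one_pow] at h1
      obtain ⟨h2, h3, t, ht, hft⟩ := h1
      exact ⟨max s t, le_max_left _ _, le_top, h2 _ (hs.trans_le (le_max_left _ _)), h3, t,
        ⟨ht, le_max_right _ _⟩, hft⟩
    | coe c =>
      have hc := EReal.coe_pos.1 hA.pos
      have h1 := hfg.1 c hstar
      rw [hA.lambdaDR_eq_zero hμ hμ0 h hu hp, isDREigenfunction_iff hμ hμ0 hc, add_zero] at h1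
      obtain ⟨h2, h3, -, t, ht, hft⟩ := h1
      refine ⟨c, EReal.coe_le_coe_iff.1 hsA, le_rfl, h2, h3, t, ⟨ht.1.lt_of_ne ?_, ht.2⟩, hft⟩
      rintro rfl
      exact hft h3
  have hupos : ∀ τ ∈ Ioc 0 b, 0 < u τ := fun τ hτ =>
    hA.fst_pos h hN hu hp hτ.1 ((EReal.coe_le_coe_iff.2 hτ.2).trans hbA)
  have hs' : s ∈ Ioc 0 b := ⟨hs, hsb⟩
  have hus := (hupos s hs').ne'
  have hfs : f s ≠ 0 := by
    have h1 := (h b).ratio_eq hu hupos hflow hf s hs' t ht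
    intro h0
    rw [h0, zero_div, eq_comm, div_eq_zero_iff] at h1
    exact h1.elim hft (hupos t ht).ne'
  have hW := (h b).wronskian hu hflow hf s (Ioc_subset_Icc_self hs')
  have hNs := (hμ0 s hs.le).ne'
  rw [div_div, div_eq_div_iff (mul_ne_zero (pow_ne_zero 2 hNs) hus) hfs]
  linarith

end FirstFunction

end

/-! ### The semigroup estimate in the original variables -/

theorem theorem1p10 {H : Type*} [NormedAddCommGroup H] [InnerProductSpace ℂ H] [CompleteSpace H]
    (S : StrongSemigroup H) (ω r : ℝ) (hr : S.HasResolventRadius ω r)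
    (m : ℝ → ℝ) (hm : ContDiffOn ℝ 1 m (Set.Ici 0)) (hpos : ∀ t : ℝ, 0 ≤ t → 0 < m t)
    (hS : ∀ t : ℝ, 0 < t → ‖S.toFun t‖ ≤ m t) :
    ∃ (A : EReal) (ψ : ℝ → ℝ),
      -- `(A, ψ)` is the pair attached to `(m, ω, r)`, and it is unique
      IsHatPair ω r m A ψ ∧
      (∀ (A' : EReal) (ψ' : ℝ → ℝ), IsHatPair ω r m A' ψ' →
        A' = A ∧ ∀ s : ℝ, 0 < s → (s : EReal) ≤ A → ψ' s = ψ s) ∧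
      -- the relation with `a*` and `ψ₀` for the rescaled weight
      (r : EReal) * A = aStar (rescaledWeight ω r m) ∧
      (∃ u v : ℝ → ℝ, IsFirstFunction (rescaledWeight ω r m) u v) ∧
      (∀ u v : ℝ → ℝ, IsFirstFunction (rescaledWeight ω r m) u v →
        ∀ s : ℝ, 0 < s → (s : EReal) ≤ A → ψ s = v (r * s) / u (r * s)) ∧
      -- the estimate
      (∀ a b t : ℝ, 0 < a → (a : EReal) ≤ A → 0 < b → (b : EReal) ≤ A → a + b < t →
        ‖S.toFun t‖ ≤ hatBound ω r m ψ t a b) ∧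
      -- for finite `A` the choice `a = b = A` is optimal, and the form of the estimate there
      (∀ c : ℝ, A = c →
        (∀ a b t : ℝ, 0 < a → a ≤ c → 0 < b → b ≤ c →
          hatBound ω r m ψ t c c ≤ hatBound ω r m ψ t a b) ∧
        (∀ t : ℝ, hatBound ω r m ψ t c c = Real.exp ((ω - r) * (t - 2 * c)) * m c ^ 2) ∧
        (∀ t : ℝ, 2 * c < t →
          ‖S.toFun t‖ ≤ Real.exp ((ω - r) * (t - 2 * c)) * m c ^ 2)) := by
  have hr0 : 0 < r := hr.1
  set M : ℝ → ℝ := fun s => Real.exp (-(ω * s)) * m s with hMdef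
  set μ : ℝ → ℝ := rescaledWeight ω r m with hμdef
  have hM : ContDiffOn ℝ 1 M (Ici 0) :=
    (ContDiff.contDiffOn (by fun_prop : ContDiff ℝ 1 fun s : ℝ => Real.exp (-(ω * s)))).mul hm
  have hM0 : ∀ s, 0 ≤ s → 0 < M s := fun s hs => mul_pos (Real.exp_pos _) (hpos s hs)
  have hμ : ContDiffOn ℝ 1 μ (Ici 0) :=
    hM.comp (ContDiff.contDiffOn (by fun_prop : ContDiff ℝ 1 fun s : ℝ => s / r))
      fun s hs => div_nonneg hs hr0.le
  have hμ0 : ∀ s, 0 ≤ s → 0 < μ s := fun s hs => hM0 (s / r) (div_nonneg hs hr0.le)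
  have hμM : ∀ s, μ (r * s) = M s := fun s => by
    simp only [hμdef, hMdef, rescaledWeight, mul_div_cancel_left₀ s hr0.ne']
  have hN : ∀ s, 0 ≤ s → 0 < μ s ^ 2 := fun s hs => pow_pos (hμ0 s hs) 2
  obtain ⟨u, p, hu, hp, h⟩ := exists_isFlow_forall 1 (hμ.continuousOn.pow 2) hN
  replace h : ∀ T, IsFlow id (fun s => μ s ^ 2) 1 T u p := h
  obtain ⟨A₁, hA₁⟩ := exists_isFirstRobinPoint (N := fun s => μ s ^ 2) (hμ.continuousOn.pow 2)
    hu hp h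
  obtain ⟨A, hrA, hA0, hAlt, hAeq⟩ := exists_ereal_div hr0 hA₁.pos
  have hAle : ∀ s : ℝ, (s : EReal) ≤ A → ((r * s : ℝ) : EReal) ≤ A₁ := fun s hs => by
    rcases hs.lt_or_eq with h1 | h1
    · exact ((hAlt s).1 h1).le
    · exact ((hAeq s).1 h1.symm).ge
  -- the solution in the original variable `ŝ = s / r`
  set U : ℝ → ℝ := fun s => u (r * s) with hU
  set P : ℝ → ℝ := fun s => r * p (r * s) with hP
  set V : ℝ → ℝ := fun s => P s / M s ^ 2 with hV
  have hhat : ∀ T, IsFlow id (fun s => M s ^ 2) (r ^ 2) T U P := fun T => by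
    have := IsFlow.comp_mul h hr0 T
    simpa only [hμM] using this
  have hhat' : ∀ T, IsFlow id (fun s => M s ^ 2) (r ^ 2) T U (fun s => M s ^ 2 * V s) := fun T =>
    (hhat T).congr (fun _ _ => rfl) fun s hs =>
      mul_div_cancel₀ _ (pow_pos (hM0 s hs.1) 2).ne'
  have hU0 : U 0 = 0 := by simp [hU, hu]
  have hUpos : ∀ s : ℝ, 0 < s → (s : EReal) ≤ A → 0 < U s := fun s hs hsA =>
    hA₁.fst_pos h hN hu hp (mul_pos hr0 hs) (hAle s hsA)
  have hPpos : ∀ s : ℝ, 0 < s → (s : EReal) ≤ A → 0 < P s := fun s hs hsA =>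
    mul_pos hr0 (hA₁.snd_pos h hN hu hp (mul_pos hr0 hs).le (hAle s hsA))
  have hVlt : ∀ s : ℝ, 0 < s → (s : EReal) < A → 0 < U s ∧ U s < V s / r := by
    intro s hs hsA
    refine ⟨hUpos s hs hsA.le, ?_⟩
    have h1 := hA₁.lt (r * s) (mul_pos hr0 hs) ((hAlt s).1 hsA)
    have h2 := pow_pos (hM0 s hs.le) 2
    rw [hμM] at h1
    rw [lt_div_iff₀ hr0, lt_div_iff₀ h2]
    have := mul_lt_mul_of_pos_left h1 hr0
    simp only [hU, hP]
    linarith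
  have hVeq : ∀ c : ℝ, A = c → 0 < U c ∧ V c / r = U c := by
    intro c hc
    have hc0 : 0 < c := EReal.coe_pos.1 (hc ▸ hA0)
    refine ⟨hUpos c hc0 hc.ge, ?_⟩
    have h1 := hA₁.eq (r * c) ((hAeq c).1 hc)
    have h2 := (hM0 c hc0.le).ne'
    rw [hμM] at h1
    simp only [hV, hU, hP, h1]
    field_simp
  have hRle : ∀ s : ℝ, 0 < s → (s : EReal) ≤ A → r * M s ^ 2 * U s ≤ P s := by
    intro s hs hsA
    have h1 := hA₁.le (mul_pos hr0 hs) (hAle s hsA)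
    rw [hμM] at h1
    have := mul_le_mul_of_nonneg_left h1 hr0.le
    simp only [hU, hP]
    linarith
  set ψ : ℝ → ℝ := fun s => V s / r / U s with hψ
  have hharm : IsHarmonicFromZero r M U V := by
    rw [isHarmonicFromZero_iff hM hM0 hr0]
    obtain ⟨s, hs0, hsA⟩ := EReal.lt_iff_exists_real_btwn.1 hA0
    have hs := EReal.coe_pos.1 hs0
    exact ⟨fun b _ => hhat' b, hU0, s, hs, (hUpos s hs hsA.le).ne'⟩
  -- `e^{(r - ω) s} m ψ^{1/2}` is the square root of the decreasing quantity `e^{2 r s} P / (r U)`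
  have hsqrt : ∀ s : ℝ, 0 < s → (s : EReal) ≤ A → Real.exp ((r - ω) * s) * m s * √(ψ s) =
      √(Real.exp (2 * r * s) * (P s / (r * U s))) := fun s hs hsA =>
    exp_mul_sqrt_eq hr0 (hpos s hs.le) (hUpos s hs hsA)
  have hest : ∀ a b t : ℝ, 0 < a → (a : EReal) ≤ A → 0 < b → (b : EReal) ≤ A → a + b < t →
      ‖S.toFun t‖ ≤ hatBound ω r m ψ t a b := by
    intro a b t ha haA hb hbA hab
    have hQ : ∀ s : ℝ, 0 < s → (s : EReal) ≤ A → 0 ≤ Real.exp (2 * r * s) * (P s / (r * U s)) :=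
      fun s hs hsA => mul_nonneg (Real.exp_pos _).le
        (div_nonneg (hPpos s hs hsA).le (mul_pos hr0 (hUpos s hs hsA)).le)
    have hloc : ∀ c : ℝ, (c : EReal) ≤ A → ∀ s ∈ Ioc 0 c, 0 < U s ∧ r * M s ^ 2 * U s ≤ P s :=
      fun c hcA s hs =>
        have hsA := (EReal.coe_le_coe_iff.2 hs.2).trans hcA
        ⟨hUpos s hs.1 hsA, hRle s hs.1 hsA⟩
    rw [hatBound_eq, hsqrt a ha haA, hsqrt b hb hbA]
    refine ContinuousLinearMap.opNorm_le_bound _ (by positivity) fun x => ?_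
    have h1 := S.orbit_le hr hm.continuousOn hpos hS (N := fun s => M s ^ 2) (fun _ => rfl) hhat
      hU0 ha hb hab (hUpos a ha haA) (hUpos b hb hbA) (hPpos b hb hbA) (hloc a haA) (hloc b hbA) x
    have h2 : Real.exp (-(2 * r * (t - (a + b)))) * (P a / (r * U a)) * (P b / (r * U b)) *
        ‖x‖ ^ 2 = (Real.exp (-(r * t)) * √(Real.exp (2 * r * a) * (P a / (r * U a))) *
        √(Real.exp (2 * r * b) * (P b / (r * U b))) * ‖x‖) ^ 2 := by
      rw [mul_pow, mul_pow, mul_pow, Real.sq_sqrt (hQ a ha haA), Real.sq_sqrt (hQ b hb hbA)]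
      have : Real.exp (-(2 * r * (t - (a + b)))) =
          Real.exp (-(r * t)) ^ 2 * Real.exp (2 * r * a) * Real.exp (2 * r * b) := by
        rw [← Real.exp_nat_mul, ← Real.exp_add, ← Real.exp_add]
        congr 1
        push_cast
        ring
      rw [this]
      ring
    rw [h2] at h1
    have h3 := le_of_sq_le_sq h1 (by positivity)
    have h4 : Real.exp ((ω - r) * t) = Real.exp (ω * t) * Real.exp (-(r * t)) := by
      rw [← Real.exp_add]; congr 1; ring
    have h5 : Real.exp (ω * t) * Real.exp (-(ω * t)) = 1 := by
      rw [← Real.exp_add]; simp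
    calc ‖S.toFun t x‖ = Real.exp (ω * t) * (Real.exp (-(ω * t)) * ‖S.toFun t x‖) := by
          rw [← mul_assoc, h5, one_mul]
      _ ≤ Real.exp (ω * t) * _ := mul_le_mul_of_nonneg_left h3 (Real.exp_pos _).le
      _ = _ := by rw [h4]; ring
  refine ⟨A, ψ, ⟨hA0, U, V, hharm, hVlt, hVeq, fun _ _ _ => rfl⟩, ?_, ?_, ?_, ?_, hest, ?_⟩
  · rintro A' ψ' ⟨hA0', u', v', hharm', hlt', heq', hψ'⟩
    obtain ⟨hflow', hu', -⟩ := (isHarmonicFromZero_iff hM hM0 hr0).1 hharm'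
    obtain ⟨hAA, hrat⟩ := hatPair_unique hM0 hr0 (fun b _ => hhat' b) hU0 hflow' hu' hA0 hA0'
      hVlt hVeq hlt' heq'
    exact ⟨hAA, fun s hs hsA => (hψ' s hs (hAA ▸ hsA)).trans (hrat s hs hsA)⟩
  · rw [hrA, hA₁.aStar_eq hμ hμ0 h hu hp]
  · exact ⟨u, _, isFirstFunction_of_isFirstRobinPoint hμ hμ0 hA₁ h hu hp⟩
  · intro f g hfg s hs hsA
    rw [← firstFunction_ratio hμ hμ0 hA₁ h hu hp hfg (mul_pos hr0 hs) (hAle s hsA), hμM]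
    simp only [hψ, hV, hP, hU]
    field_simp
  · intro c hc
    have hc0 : 0 < c := EReal.coe_pos.1 (hc ▸ hA0)
    have hψc : ψ c = 1 := by
      simp only [hψ]
      rw [(hVeq c hc).2, div_self (hVeq c hc).1.ne']
    have hform : ∀ t : ℝ,
        hatBound ω r m ψ t c c = Real.exp ((ω - r) * (t - 2 * c)) * m c ^ 2 := by
      intro t
      rw [hatBound, hψc, Real.sqrt_one, ← two_mul]
      ring
    refine ⟨fun a b t ha hac hb hbc => ?_, hform, fun t ht => ?_⟩
    · have hle : ∀ s : ℝ, s ≤ c → (s : EReal) ≤ A := fun s hs =>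
        hc ▸ EReal.coe_le_coe_iff.2 hs
      have hanti : ∀ a, 0 < a → a ≤ c →
          √(Real.exp (2 * r * c) * (P c / (r * U c))) ≤
            √(Real.exp (2 * r * a) * (P a / (r * U a))) := fun a ha hac =>
        Real.sqrt_le_sqrt ((hhat c).exp_mul_ratio_antitone hr0
          (fun s hs => pow_pos (hM0 s hs.1) 2) (fun s hs => hUpos s hs.1 (hle s hs.2)) ha hac)
      rw [hatBound_eq, hatBound_eq, hsqrt c hc0 (hle c le_rfl), hsqrt a ha (hle a hac),
        hsqrt b hb (hle b hbc)]
      have h1 := hanti a ha hac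
      have h2 := hanti b hb hbc
      gcongr
    · rw [← hform t]
      exact hest c c t hc0 hc.ge hc0 hc.ge (by linarith)
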